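/- Let $0<q<1$. Let $U_q\mathfrak{sl}_2$ be the algebra with generators $K^{\pm1},E,F$ and relations $KK^{-1}=K^{-1}K=1$, $K^{\pm1}E=q^{\pm2}EK^{\pm1}$, $K^{\pm1}F=q^{\mp2}FK^{\pm1}$, $EF-FE=(K-K^{-1})/(q-q^{-1})$, with coproduct $\Delta(K)=K\otimes K$, $\Delta(E)=E\otimes1+K\otimes E$, $\Delta(F)=F\otimes K^{-1}+1\otimes F$, and let $$\Omega=FE+\frac{1}{(q^{-1}-q)^2}\bigl(q^{-1}K^{-1}+qK-(q^{-1}+q)\bigr).$$ Let $\mathrm{Pol}(\mathbb C)_q$ be the algebra generated by $z,z^*$ with $z^*z=q^2zz^*+1-q^2$. Let $D(U)_q'$ be the space of formal series $\sum_{j,k\ge0}a_{jk}z^jz^{*k}$ with the topology of coefficientwise convergence, a $\mathrm{Pol}(\mathbb C)_q$-bimodule, and let $D(U)_q$ be the space of those $f\in D(U)_q'$ with $z^{*N}f=fz^N=0$ for some $N$. The algebra $U_q\mathfrak{sl}_2$ acts on $D(U)_q'$ by the extension by continuity of the covariant action on $\mathrm{Pol}(\mathbb C)_q$ given by $Kz=q^2z$,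 $Fz=q^{1/2}$, $Ez=-q^{1/2}z^2$, $Kz^*=q^{-2}z^*$, $Ez^*=q^{-3/2}$, $Fz^*=-q^{5/2}z^{*2}$. Put $e_n=z^nf_0$, where $z^*f_0=0$, so that $ze_n=e_{n+1}$ and $z^*e_n=(1-q^{2n})e_{n-1}$. In this representation $D(U)_q$ is identified with the algebra of matrices $(f_{mn})_{m,n\ge0}$ with finitely many nonzero entries, and $D(U)_q'$ with the space of all matrices. For a function $\psi$ on $q^{-2\mathbb Z_+}$ let $\psi(x)\in D(U)_q'$, $x=(1-zz^*)^{-1}$, be the distribution with the diagonal matrix $\mathrm{diag}(\psi(q^{-2m}))_{m\ge0}$. For $f\in D(U)_q$ let $\int f\,d\nu=(1-q^2)\sum_{m\ge0}f_{mm}q^{-2m}$. Let $\overline\partial$ be the continuous operator from $D(U)_q'$ to the $(0,1)$-forms $g\,dz^*$, $g\in D(U)_q'$, that satisfies the Leibniz rule and $\overline\partial z=0$, $\overline\partial z^*=dz^*$, where $dz^*\,z=q^2z\,dz^*$ and $dz^*\,z^*=q^{-2}z^*dz^*$. Let $\square=-\overline\partial^*\overline\partial$ on $D(U)_q$, that is,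 $\square f\in D(U)_q$ and $(\square f,h)=-(\overline\partial f,\overline\partial h)$ for all $f,h\in D(U)_q$, with respect to the scalar products $(f,h)=\int h^*f\,d\nu$ and $(f\,dz^*,h\,dz^*)=\int h^*f(1-zz^*)^2\,d\nu$. Then $\square$ extends uniquely to a continuous linear operator, also denoted $\square$, on $D(U)_q'$, and for every function $\psi:q^{-2\mathbb Z_+}\to\mathbb C$ $$\Omega\psi(x)=q\,\square\psi(x)=\bigl(q\,D\,t(q^{-1}t-1)\,D\psi\bigr)(x),\qquad (Df)(t)=\frac{f(q^{-1}t)-f(qt)}{q^{-1}t-qt}.$$ Here the right-hand side uses only the values of $\psi$ on $q^{-2\mathbb Z_+}$: at $t=1$ the undefined value $(D\psi)(q)$ enters with the coefficient $q(q^{-1}q-1)=0$. -/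

import Mathlib

open scoped BigOperators

noncomputable section

namespace QuantumDisc

/-! ### The quantum universal enveloping algebra -/

/-- Generators of `U_q sl_2`; `Ki` stands for the inverse of `K`. -/
inductive UqGen
  | K | Ki | E | F

/-- The defining relations of `U_q sl_2`. -/
inductive UqRel (q : ℝ) : FreeAlgebra ℂ UqGen → FreeAlgebra ℂ UqGen → Prop
  | K_Ki : UqRel q (FreeAlgebra.ι ℂ .K * FreeAlgebra.ι ℂ .Ki) 1
  | Ki_K : UqRel q (FreeAlgebra.ι ℂ .Ki * FreeAlgebra.ι ℂ .K) 1
  | K_E : UqRel q (FreeAlgebra.ι ℂ .K * FreeAlgebra.ι ℂ .E)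
      ((q : ℂ) ^ 2 • (FreeAlgebra.ι ℂ .E * FreeAlgebra.ι ℂ .K))
  | Ki_E : UqRel q (FreeAlgebra.ι ℂ .Ki * FreeAlgebra.ι ℂ .E)
      ((q : ℂ)⁻¹ ^ 2 • (FreeAlgebra.ι ℂ .E * FreeAlgebra.ι ℂ .Ki))
  | K_F : UqRel q (FreeAlgebra.ι ℂ .K * FreeAlgebra.ι ℂ .F)
      ((q : ℂ)⁻¹ ^ 2 • (FreeAlgebra.ι ℂ .F * FreeAlgebra.ι ℂ .K))
  | Ki_F : UqRel q (FreeAlgebra.ι ℂ .Ki * FreeAlgebra.ι ℂ .F)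
      ((q : ℂ) ^ 2 • (FreeAlgebra.ι ℂ .F * FreeAlgebra.ι ℂ .Ki))
  | E_F : UqRel q
      (FreeAlgebra.ι ℂ .E * FreeAlgebra.ι ℂ .F - FreeAlgebra.ι ℂ .F * FreeAlgebra.ι ℂ .E)
      (((q : ℂ) - (q : ℂ)⁻¹)⁻¹ • (FreeAlgebra.ι ℂ .K - FreeAlgebra.ι ℂ .Ki))

/-- The algebra `U_q sl_2`. -/
abbrev Uq (q : ℝ) : Type := RingQuot (UqRel q)

namespace Uq

/-- The image of a generator in `U_q sl_2`. -/
def gen (q : ℝ) (g : UqGen) : Uq q := RingQuot.mkAlgHom ℂ (UqRel q) (FreeAlgebra.ι ℂ g)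

abbrev K (q : ℝ) : Uq q := gen q .K
abbrev Ki (q : ℝ) : Uq q := gen q .Ki
abbrev E (q : ℝ) : Uq q := gen q .E
abbrev F (q : ℝ) : Uq q := gen q .F

/-- The Casimir element
`Ω = F E + (q⁻¹ - q)⁻² (q⁻¹ K⁻¹ + q K - (q⁻¹ + q))`. -/
def casimir (q : ℝ) : Uq q :=
  F q * E q + (1 / ((q : ℂ)⁻¹ - (q : ℂ)) ^ 2) •
    ((q : ℂ)⁻¹ • Ki q + (q : ℂ) • K q - ((q : ℂ)⁻¹ + (q : ℂ)) • (1 : Uq q))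

end Uq

/-! ### Polynomials on the quantum plane -/

/-- Generators `z`, `z*`. -/
inductive PolGen
  | z | zs

/-- The relation `z* z = q² z z* + 1 - q²`. -/
inductive PolRel (q : ℝ) : FreeAlgebra ℂ PolGen → FreeAlgebra ℂ PolGen → Prop
  | zs_z : PolRel q (FreeAlgebra.ι ℂ .zs * FreeAlgebra.ι ℂ .z)
      ((q : ℂ) ^ 2 • (FreeAlgebra.ι ℂ .z * FreeAlgebra.ι ℂ .zs) + (1 - (q : ℂ) ^ 2) • 1)

/-- The algebra `Pol(ℂ)_q`. -/
abbrev Pol (q : ℝ) : Type := RingQuot (PolRel q)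

namespace Pol

def z (q : ℝ) : Pol q := RingQuot.mkAlgHom ℂ (PolRel q) (FreeAlgebra.ι ℂ .z)
def zs (q : ℝ) : Pol q := RingQuot.mkAlgHom ℂ (PolRel q) (FreeAlgebra.ι ℂ .zs)

end Pol

/-! ### Distributions -/

/-- The space `D(U)_q'` of distributions: `f` is the formal series `∑ f j k z^j z*^k`. The
topology (product topology) is that of coefficientwise convergence. -/
abbrev Distr : Type := ℕ → ℕ → ℂ

/-- Complex conjugation of distributions, `(∑ a_jk z^j z*^k)^* = ∑ conj(a_jk) z^k z*^j`. -/
def conjDistr (f : Distr) : Distr := fun j k => (starRingEnd ℂ) (f k j)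

/-- The distribution `1`. -/
def one : Distr := fun j k => if j = 0 ∧ k = 0 then 1 else 0

/-- Left multiplication by `z`: `z · z^j z*^k = z^(j+1) z*^k`. -/
def lz : Distr →L[ℂ] Distr where
  toFun f j k := if j = 0 then 0 else f (j - 1) k
  map_add' f g := by ext j k; simp only [Pi.add_apply]; split_ifs <;> simp
  map_smul' c f := by ext j k; simp
  cont := by
    refine continuous_pi fun j => continuous_pi fun k => ?_
    by_cases h : j = 0 <;> simp only [h, if_true, if_false] <;> fun_prop

/-- Right multiplication by `z*`: `z^j z*^k · z* = z^j z*^(k+1)`. -/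
def rzs : Distr →L[ℂ] Distr where
  toFun f j k := if k = 0 then 0 else f j (k - 1)
  map_add' f g := by ext j k; simp only [Pi.add_apply]; split_ifs <;> simp
  map_smul' c f := by ext j k; simp
  cont := by
    refine continuous_pi fun j => continuous_pi fun k => ?_
    by_cases h : k = 0 <;> simp only [h, if_true, if_false] <;> fun_prop

/-- Left multiplication by `z*`:
`z* · z^j z*^k = q^(2j) z^j z*^(k+1) + (1 - q^(2j)) z^(j-1) z*^k`. -/
def lzs (q : ℝ) : Distr →L[ℂ] Distr where
  toFun f j k := (q : ℂ) ^ (2 * j) * rzs f j k + (1 - (q : ℂ) ^ (2 * (j + 1))) * f (j + 1) k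
  map_add' f g := by ext j k; simp only [map_add, Pi.add_apply]; ring
  map_smul' c f := by ext j k; simp only [map_smul, Pi.smul_apply, smul_eq_mul, RingHom.id_apply]; ring
  cont := by
    refine continuous_pi fun j => continuous_pi fun k => ?_
    fun_prop

/-- Right multiplication by `z`:
`z^j z*^k · z = q^(2k) z^(j+1) z*^k + (1 - q^(2k)) z^j z*^(k-1)`. -/
def rz (q : ℝ) : Distr →L[ℂ] Distr where
  toFun f j k := (q : ℂ) ^ (2 * k) * lz f j k + (1 - (q : ℂ) ^ (2 * (k + 1))) * f j (k + 1)
  map_add' f g := by ext j k; simp only [map_add, Pi.add_apply]; ring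
  map_smul' c f := by ext j k; simp only [map_smul, Pi.smul_apply, smul_eq_mul, RingHom.id_apply]; ring
  cont := by
    refine continuous_pi fun j => continuous_pi fun k => ?_
    fun_prop

theorem lz_apply (f : Distr) (j k : ℕ) : lz f j k = if j = 0 then 0 else f (j - 1) k := rfl
theorem rzs_apply (f : Distr) (j k : ℕ) : rzs f j k = if k = 0 then 0 else f j (k - 1) := rfl
theorem lzs_apply (q : ℝ) (f : Distr) (j k : ℕ) : lzs q f j k =
    (q : ℂ) ^ (2 * j) * rzs f j k + (1 - (q : ℂ) ^ (2 * (j + 1))) * f (j + 1) k := rfl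
theorem rz_apply (q : ℝ) (f : Distr) (j k : ℕ) : rz q f j k =
    (q : ℂ) ^ (2 * k) * lz f j k + (1 - (q : ℂ) ^ (2 * (k + 1))) * f j (k + 1) := rfl

/-- The left `Pol(ℂ)_q`-module structure of `D(U)_q'`. -/
def leftMul (q : ℝ) : Pol q →ₐ[ℂ] (Distr →L[ℂ] Distr) :=
  RingQuot.liftAlgHom ℂ ⟨FreeAlgebra.lift ℂ (fun | .z => lz | .zs => lzs q), by
    rintro _ _ ⟨⟩
    ext f j k
    rcases j with _ | j <;> rcases k with _ | k <;>
      simp [lz_apply, rzs_apply, lzs_apply] <;> ring⟩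

/-- The right `Pol(ℂ)_q`-module structure of `D(U)_q'`. -/
def rightMul (q : ℝ) : Pol q →ₐ[ℂ] (Distr →L[ℂ] Distr)ᵐᵒᵖ :=
  RingQuot.liftAlgHom ℂ ⟨FreeAlgebra.lift ℂ
    (fun | .z => MulOpposite.op (rz q) | .zs => MulOpposite.op rzs), by
    rintro _ _ ⟨⟩
    apply MulOpposite.unop_injective
    ext f j k
    rcases j with _ | j <;> rcases k with _ | k <;>
      simp [lz_apply, rzs_apply, rz_apply] <;> ring⟩

/-- The product `p · f` of a polynomial and a distribution. -/
def lmul (q : ℝ) (p : Pol q) (f : Distr) : Distr := leftMul q p f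

/-- The product `f · p` of a distribution and a polynomial. -/
def rmul (q : ℝ) (f : Distr) (p : Pol q) : Distr := (rightMul q p).unop f

theorem lmul_z (q : ℝ) (f : Distr) : lmul q (Pol.z q) f = lz f := by
  simp [lmul, leftMul, Pol.z]
theorem lmul_zs (q : ℝ) (f : Distr) : lmul q (Pol.zs q) f = lzs q f := by
  simp [lmul, leftMul, Pol.zs]
theorem rmul_z (q : ℝ) (f : Distr) : rmul q f (Pol.z q) = rz q f := by
  simp [rmul, rightMul, Pol.z]
theorem rmul_zs (q : ℝ) (f : Distr) : rmul q f (Pol.zs q) = rzs f := by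
  simp [rmul, rightMul, Pol.zs]

/-- `f ∈ D(U)_q`: the distribution `f` is a finite function in the quantum disc. -/
def IsFiniteFun (q : ℝ) (f : Distr) : Prop :=
  ∃ N : ℕ, lmul q (Pol.zs q ^ N) f = 0 ∧ rmul q f (Pol.z q ^ N) = 0

/-! ### The action of `U_q sl_2` on distributions -/

/-- The structure of a covariant `U_q sl_2`-module on `D(U)_q'`, by continuous operators.
The coproduct is `Δ K = K ⊗ K`, `Δ E = E ⊗ 1 + K ⊗ E`, `Δ F = F ⊗ K⁻¹ + 1 ⊗ F`, and
`K z = q² z`, `E z = -q^(1/2) z²`, `F z = q^(1/2)`,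
`K z* = q⁻² z*`, `E z* = q^(-3/2)`, `F z* = -q^(5/2) z*²`. The listed fields say that `1` is
invariant and that `ξ (p · f) = ∑ (ξ' p) · (ξ'' f)` for the generators `p = z, z*`. They
determine the action on `Pol(ℂ)_q`, hence, by continuity, on `D(U)_q'`. -/
structure CovariantAction (q : ℝ) where
  act : Uq q →ₐ[ℂ] (Distr →L[ℂ] Distr)
  K_one : act (Uq.K q) one = one
  E_one : act (Uq.E q) one = 0
  F_one : act (Uq.F q) one = 0
  K_z : ∀ f, act (Uq.K q) (lmul q (Pol.z q) f) =
    (q : ℂ) ^ 2 • lmul q (Pol.z q) (act (Uq.K q) f)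
  K_zs : ∀ f, act (Uq.K q) (lmul q (Pol.zs q) f) =
    (q : ℂ)⁻¹ ^ 2 • lmul q (Pol.zs q) (act (Uq.K q) f)
  E_z : ∀ f, act (Uq.E q) (lmul q (Pol.z q) f) =
    -(√q : ℂ) • lmul q (Pol.z q ^ 2) f + (q : ℂ) ^ 2 • lmul q (Pol.z q) (act (Uq.E q) f)
  E_zs : ∀ f, act (Uq.E q) (lmul q (Pol.zs q) f) =
    (√q : ℂ)⁻¹ ^ 3 • f + (q : ℂ)⁻¹ ^ 2 • lmul q (Pol.zs q) (act (Uq.E q) f)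
  F_z : ∀ f, act (Uq.F q) (lmul q (Pol.z q) f) =
    (√q : ℂ) • act (Uq.Ki q) f + lmul q (Pol.z q) (act (Uq.F q) f)
  F_zs : ∀ f, act (Uq.F q) (lmul q (Pol.zs q) f) =
    -(√q : ℂ) ^ 5 • lmul q (Pol.zs q ^ 2) (act (Uq.Ki q) f) +
      lmul q (Pol.zs q) (act (Uq.F q) f)

/-- `1 + c + ⋯ + c^(n-1)`. -/
def geom (c : ℂ) (n : ℕ) : ℂ := ∑ i ∈ Finset.range n, c ^ i

/-- `z^j z*^k ↦ q^(2(j-k)) z^j z*^k`. -/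
def opK (q : ℝ) : Distr →L[ℂ] Distr where
  toFun f j k := (q : ℂ) ^ (2 * j) * (q : ℂ)⁻¹ ^ (2 * k) * f j k
  map_add' f g := by ext j k; simp only [Pi.add_apply]; ring
  map_smul' c f := by ext j k; simp only [Pi.smul_apply, smul_eq_mul, RingHom.id_apply]; ring
  cont := by refine continuous_pi fun j => continuous_pi fun k => ?_; fun_prop

/-- `z^j z*^k ↦ q^(2(k-j)) z^j z*^k`. -/
def opKi (q : ℝ) : Distr →L[ℂ] Distr where
  toFun f j k := (q : ℂ)⁻¹ ^ (2 * j) * (q : ℂ) ^ (2 * k) * f j k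
  map_add' f g := by ext j k; simp only [Pi.add_apply]; ring
  map_smul' c f := by ext j k; simp only [Pi.smul_apply, smul_eq_mul, RingHom.id_apply]; ring
  cont := by refine continuous_pi fun j => continuous_pi fun k => ?_; fun_prop

/-- `z^j z*^k ↦ (E z^j) z*^k + (K z^j)(E z*^k)`, where
`E z^j = -q^(1/2) (1 + q² + ⋯ + q^(2j-2)) z^(j+1)` and
`E z*^k = q^(-3/2) (1 + q⁻² + ⋯ + q^(-2k+2)) z*^(k-1)`. -/
def opE (q : ℝ) : Distr →L[ℂ] Distr where
  toFun f j k := -(√q : ℂ) * geom ((q : ℂ) ^ 2) (j - 1) * f (j - 1) k +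
    (q : ℂ) ^ (2 * j) * (√q : ℂ)⁻¹ ^ 3 * geom ((q : ℂ)⁻¹ ^ 2) (k + 1) * f j (k + 1)
  map_add' f g := by ext j k; simp only [Pi.add_apply]; ring
  map_smul' c f := by ext j k; simp only [Pi.smul_apply, smul_eq_mul, RingHom.id_apply]; ring
  cont := by refine continuous_pi fun j => continuous_pi fun k => ?_; fun_prop

/-- `z^j z*^k ↦ (F z^j)(K⁻¹ z*^k) + z^j (F z*^k)`, where
`F z^j = q^(1/2) (1 + q⁻² + ⋯ + q^(-2j+2)) z^(j-1)` and
`F z*^k = -q^(5/2) (1 + q² + ⋯ + q^(2k-2)) z*^(k+1)`. -/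
def opF (q : ℝ) : Distr →L[ℂ] Distr where
  toFun f j k := (√q : ℂ) * geom ((q : ℂ)⁻¹ ^ 2) (j + 1) * (q : ℂ) ^ (2 * k) * f (j + 1) k -
    (√q : ℂ) ^ 5 * geom ((q : ℂ) ^ 2) (k - 1) * f j (k - 1)
  map_add' f g := by ext j k; simp only [Pi.add_apply]; ring
  map_smul' c f := by ext j k; simp only [Pi.smul_apply, smul_eq_mul, RingHom.id_apply]; ring
  cont := by refine continuous_pi fun j => continuous_pi fun k => ?_; fun_prop

theorem opK_apply (q : ℝ) (f : Distr) (j k : ℕ) :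
    opK q f j k = (q : ℂ) ^ (2 * j) * (q : ℂ)⁻¹ ^ (2 * k) * f j k := rfl
theorem opKi_apply (q : ℝ) (f : Distr) (j k : ℕ) :
    opKi q f j k = (q : ℂ)⁻¹ ^ (2 * j) * (q : ℂ) ^ (2 * k) * f j k := rfl
theorem opE_apply (q : ℝ) (f : Distr) (j k : ℕ) :
    opE q f j k = -(√q : ℂ) * geom ((q : ℂ) ^ 2) (j - 1) * f (j - 1) k +
    (q : ℂ) ^ (2 * j) * (√q : ℂ)⁻¹ ^ 3 * geom ((q : ℂ)⁻¹ ^ 2) (k + 1) * f j (k + 1) := rfl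
theorem opF_apply (q : ℝ) (f : Distr) (j k : ℕ) :
    opF q f j k = (√q : ℂ) * geom ((q : ℂ)⁻¹ ^ 2) (j + 1) * (q : ℂ) ^ (2 * k) * f (j + 1) k -
    (√q : ℂ) ^ 5 * geom ((q : ℂ) ^ 2) (k - 1) * f j (k - 1) := rfl

theorem geom_zero (c : ℂ) : geom c 0 = 0 := by simp [geom]
theorem geom_succ (c : ℂ) (n : ℕ) : geom c (n + 1) = geom c n + c ^ n := by
  simp [geom, Finset.sum_range_succ]

section
variable {q : ℝ}

theorem cast_ne_zero (hq : q ∈ Set.Ioo (0 : ℝ) 1) : (q : ℂ) ≠ 0 := by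
  exact_mod_cast hq.1.ne'
theorem cast_pow_ne_one (hq : q ∈ Set.Ioo (0 : ℝ) 1) (n : ℕ) : 1 - (q : ℂ) ^ (n + 1) ≠ 0 := by
  have : q ^ (n + 1) < 1 := pow_lt_one₀ hq.1.le hq.2 (by omega)
  have h : (1 - q ^ (n + 1) : ℝ) ≠ 0 := by linarith
  exact_mod_cast h
theorem sqrt_sq' (hq : q ∈ Set.Ioo (0 : ℝ) 1) : (√q : ℂ) ^ 2 = (q : ℂ) := by
  exact_mod_cast Real.sq_sqrt hq.1.le
theorem sqrt_ne_zero' (hq : q ∈ Set.Ioo (0 : ℝ) 1) : (√q : ℂ) ≠ 0 := by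
  exact_mod_cast (Real.sqrt_pos.mpr hq.1).ne'

theorem geom_sq (hq : q ∈ Set.Ioo (0 : ℝ) 1) (n : ℕ) :
    geom ((q : ℂ) ^ 2) n = (1 - (q : ℂ) ^ (2 * n)) / (1 - (q : ℂ) ^ 2) := by
  have h := cast_pow_ne_one hq 1
  rw [eq_div_iff h]
  induction n with
  | zero => simp [geom_zero]
  | succ n ih => rw [geom_succ, add_mul, ih]; ring

theorem geom_inv_sq (hq : q ∈ Set.Ioo (0 : ℝ) 1) (n : ℕ) :
    geom ((q : ℂ)⁻¹ ^ 2) n =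
      (q : ℂ) ^ 2 * ((q : ℂ)⁻¹ ^ (2 * n) - 1) / (1 - (q : ℂ) ^ 2) := by
  have h := cast_pow_ne_one hq 1
  have h0 := cast_ne_zero hq
  rw [eq_div_iff h]
  induction n with
  | zero => simp [geom_zero]
  | succ n ih =>
    have h1 : (q : ℂ) ^ 2 * (q : ℂ)⁻¹ ^ 2 = 1 := by field_simp
    rw [geom_succ, add_mul, ih]
    linear_combination (-(q : ℂ)⁻¹ ^ (2 * n)) * h1

theorem uq_relations (hq : q ∈ Set.Ioo (0 : ℝ) 1) ⦃x y : FreeAlgebra ℂ UqGen⦄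
    (h : UqRel q x y) :
    FreeAlgebra.lift ℂ (fun | .K => opK q | .Ki => opKi q | .E => opE q | .F => opF q :
      UqGen → (Distr →L[ℂ] Distr)) x =
    FreeAlgebra.lift ℂ (fun | .K => opK q | .Ki => opKi q | .E => opE q | .F => opF q :
      UqGen → (Distr →L[ℂ] Distr)) y := by
  have h0 := cast_ne_zero hq
  have h2 := cast_pow_ne_one hq 1
  have hI : (q : ℂ) * (q : ℂ)⁻¹ = 1 := mul_inv_cancel₀ h0
  have hIn : ∀ n : ℕ, (q : ℂ)⁻¹ ^ n = ((q : ℂ) ^ n)⁻¹ := fun n => inv_pow _ _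
  cases h
  case E_F =>
    have hs := sqrt_sq' hq
    have hs0 := sqrt_ne_zero' hq
    have h3 : (q : ℂ) - (q : ℂ)⁻¹ ≠ 0 := by
      intro h
      apply h2
      have : (q : ℂ) * ((q : ℂ) - (q : ℂ)⁻¹) = 0 := by rw [h, mul_zero]
      linear_combination -this - hI
    have h4 : ((q : ℂ) - (q : ℂ)⁻¹)⁻¹ = -(q : ℂ) / (1 - (q : ℂ) ^ 2) := by
      rw [eq_div_iff h2, inv_mul_eq_iff_eq_mul₀ h3]
      linear_combination -hI
    have h5 : 1 - (√q : ℂ) ^ 4 ≠ 0 := by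
      rw [show (√q : ℂ) ^ 4 = ((√q : ℂ) ^ 2) ^ (1 + 1) by ring, hs]; exact h2
    ext f j k
    rw [h4]
    rcases j with _ | j <;> rcases k with _ | k <;>
      simp [opK_apply, opKi_apply, opE_apply, opF_apply, geom_zero] <;>
      simp only [← inv_pow, geom_sq hq, geom_inv_sq hq] <;>
      simp only [← hs, inv_pow, ← pow_mul] <;> field_simp <;> ring
  all_goals
    ext f j k
    rcases j with _ | j <;> rcases k with _ | k <;>
      simp [opK_apply, opKi_apply, opE_apply, opF_apply, geom_zero] <;> field_simp <;> try ring

theorem sqrt_pow_four_ne_one (hq : q ∈ Set.Ioo (0 : ℝ) 1) : 1 - (√q : ℂ) ^ 4 ≠ 0 := by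
  rw [show (√q : ℂ) ^ 4 = ((√q : ℂ) ^ 2) ^ (1 + 1) by ring, sqrt_sq' hq]
  exact cast_pow_ne_one hq 1

/-- The covariant action of `U_q sl_2` on `D(U)_q'`. -/
def action (hq : q ∈ Set.Ioo (0 : ℝ) 1) : CovariantAction q where
  act := RingQuot.liftAlgHom ℂ ⟨FreeAlgebra.lift ℂ
    (fun | .K => opK q | .Ki => opKi q | .E => opE q | .F => opF q), uq_relations hq⟩
  K_one := by
    ext j k
    rcases j with _ | j <;> rcases k with _ | k <;> simp [Uq.gen, opK_apply, one]
  E_one := by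
    ext j k
    rcases j with _ | _ | j <;> simp [Uq.gen, opE_apply, one, geom_zero]
  F_one := by
    ext j k
    rcases k with _ | _ | k <;> simp [Uq.gen, opF_apply, one, geom_zero]
  K_z f := by
    have h0 := cast_ne_zero hq
    ext j k
    rcases j with _ | j <;> simp [Uq.gen, lmul_z, opK_apply, lz_apply]
    field_simp; ring
  K_zs f := by
    have h0 := cast_ne_zero hq
    ext j k
    rcases k with _ | k <;> simp [Uq.gen, lmul_zs, opK_apply, lzs_apply, rzs_apply] <;>
      field_simp <;> ring
  E_z f := by
    have h0 := cast_ne_zero hq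
    have hz : lmul q (Pol.z q ^ 2) f = lz (lz f) := by
      rw [← lmul_z q, ← lmul_z q, pow_two]; simp [lmul]
    rw [hz]
    have hs := sqrt_sq' hq
    have hs0 := sqrt_ne_zero' hq
    have h5 := sqrt_pow_four_ne_one hq
    ext j k
    rcases j with _ | _ | j <;>
      simp [Uq.gen, lmul_z, opE_apply, lz_apply, geom_zero] <;>
      simp only [← inv_pow, geom_sq hq, geom_inv_sq hq] <;>
      simp only [← hs, inv_pow, ← pow_mul] <;> field_simp <;> ring
  E_zs f := by
    have hs := sqrt_sq' hq
    have hs0 := sqrt_ne_zero' hq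
    have h5 := sqrt_pow_four_ne_one hq
    ext j k
    rcases j with _ | j <;> rcases k with _ | k <;>
      simp [Uq.gen, lmul_zs, opE_apply, lzs_apply, rzs_apply, geom_zero] <;>
      simp only [← inv_pow, geom_sq hq, geom_inv_sq hq] <;>
      simp only [← hs, inv_pow, ← pow_mul] <;> field_simp <;> ring
  F_z f := by
    have hs := sqrt_sq' hq
    have hs0 := sqrt_ne_zero' hq
    have h5 := sqrt_pow_four_ne_one hq
    ext j k
    rcases j with _ | j <;> rcases k with _ | k <;>
      simp [Uq.gen, lmul_z, opF_apply, opKi_apply, lz_apply, geom_zero] <;>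
      simp only [← inv_pow, geom_sq hq, geom_inv_sq hq] <;>
      simp only [← hs, inv_pow, ← pow_mul] <;> field_simp <;>
      first | ring1 | (ring_nf; simp)
  F_zs f := by
    have hz : ∀ g, lmul q (Pol.zs q ^ 2) g = lzs q (lzs q g) := fun g => by
      rw [← lmul_zs q, ← lmul_zs q, pow_two]; simp [lmul]
    rw [hz]
    have hs := sqrt_sq' hq
    have hs0 := sqrt_ne_zero' hq
    have h5 := sqrt_pow_four_ne_one hq
    ext j k
    rcases j with _ | j <;> rcases k with _ | _ | k <;>
      simp [Uq.gen, lmul_zs, opF_apply, opKi_apply, lzs_apply, rzs_apply, geom_zero] <;>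
      simp only [← inv_pow, geom_sq hq, geom_inv_sq hq] <;>
      simp only [← hs, inv_pow, ← pow_mul] <;> field_simp <;> ring

/-! ### Differential calculus -/

/-- The operator `∂̄` from distributions to `(0,1)`-forms `g dz*`, the form `g dz*` being
represented by its coefficient `g`. The relations of the calculus are `dz* z = q² z dz*` and
`dz* z* = q⁻² z* dz*`; the fields are the Leibniz rule, with `∂̄ z = 0` and `∂̄ z* = dz*`. They
determine `∂̄` on `Pol(ℂ)_q`, hence, by continuity, on `D(U)_q'`. -/
structure DbarOperator (q : ℝ) where
  op : Distr →L[ℂ] Distr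
  map_one : op one = 0
  map_z_left : ∀ f, op (lmul q (Pol.z q) f) = lmul q (Pol.z q) (op f)
  map_z_right : ∀ f, op (rmul q f (Pol.z q)) = (q : ℂ) ^ 2 • rmul q (op f) (Pol.z q)
  map_zs_right : ∀ f,
    op (rmul q f (Pol.zs q)) = (q : ℂ)⁻¹ ^ 2 • rmul q (op f) (Pol.zs q) + f

/-- `z^j z*^k ↦ (1 + q⁻² + ⋯ + q^(-2k+2)) z^j z*^(k-1)`. -/
def opDbar (q : ℝ) : Distr →L[ℂ] Distr where
  toFun f j k := geom ((q : ℂ)⁻¹ ^ 2) (k + 1) * f j (k + 1)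
  map_add' f g := by ext j k; simp only [Pi.add_apply]; ring
  map_smul' c f := by ext j k; simp only [Pi.smul_apply, smul_eq_mul, RingHom.id_apply]; ring
  cont := by refine continuous_pi fun j => continuous_pi fun k => ?_; fun_prop

theorem opDbar_apply (q : ℝ) (f : Distr) (j k : ℕ) :
    opDbar q f j k = geom ((q : ℂ)⁻¹ ^ 2) (k + 1) * f j (k + 1) := rfl

/-- The operator `∂̄`. -/
def dbar (hq : q ∈ Set.Ioo (0 : ℝ) 1) : DbarOperator q where
  op := opDbar q
  map_one := by ext j k; simp [opDbar_apply, one]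
  map_z_left f := by
    ext j k
    rcases j with _ | j <;> simp [lmul_z, opDbar_apply, lz_apply]
  map_z_right f := by
    have hs := sqrt_sq' hq
    have hs0 := sqrt_ne_zero' hq
    have h5 := sqrt_pow_four_ne_one hq
    ext j k
    rcases j with _ | j <;>
      simp [rmul_z, opDbar_apply, rz_apply, lz_apply] <;>
      simp only [← inv_pow, geom_inv_sq hq] <;>
      simp only [← hs, inv_pow, ← pow_mul] <;> field_simp <;> ring
  map_zs_right f := by
    have hs := sqrt_sq' hq
    have hs0 := sqrt_ne_zero' hq
    have h5 := sqrt_pow_four_ne_one hq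
    ext j k
    rcases k with _ | k <;>
      simp [rmul_zs, opDbar_apply, rzs_apply] <;>
      simp only [← inv_pow, geom_inv_sq hq] <;>
      simp only [← hs, inv_pow, ← pow_mul] <;> field_simp <;> ring

end

/-! ### The Fock representation, the invariant integral and the scalar products -/

/-- `e_n ↦ e_(n+1)`. -/
def fockZ : Module.End ℂ (ℕ → ℂ) where
  toFun v m := if m = 0 then 0 else v (m - 1)
  map_add' v w := by ext m; simp only [Pi.add_apply]; split_ifs <;> simp
  map_smul' c v := by ext m; simp

/-- `e_n ↦ (1 - q^(2n)) e_(n-1)`. -/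
def fockZs (q : ℝ) : Module.End ℂ (ℕ → ℂ) where
  toFun v m := (1 - (q : ℂ) ^ (2 * (m + 1))) * v (m + 1)
  map_add' v w := by ext m; simp only [Pi.add_apply]; ring
  map_smul' c v := by ext m; simp only [Pi.smul_apply, smul_eq_mul, RingHom.id_apply]; ring

theorem fockZ_apply (v : ℕ → ℂ) (m : ℕ) : fockZ v m = if m = 0 then 0 else v (m - 1) := rfl
theorem fockZs_apply (q : ℝ) (v : ℕ → ℂ) (m : ℕ) :
    fockZs q v m = (1 - (q : ℂ) ^ (2 * (m + 1))) * v (m + 1) := rfl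

/-- The Fock representation of `Pol(ℂ)_q`, in the basis `e_n = z^n f₀` of the space
`ℂ[z] f₀ = Pol(ℂ)_q f₀`, where `z* f₀ = 0`: one has `z e_n = e_(n+1)` and
`z* e_n = (1 - q^(2n)) e_(n-1)`. -/
def fockRep (q : ℝ) : Pol q →ₐ[ℂ] Module.End ℂ (ℕ → ℂ) :=
  RingQuot.liftAlgHom ℂ ⟨FreeAlgebra.lift ℂ (fun | .z => fockZ | .zs => fockZs q), by
    rintro _ _ ⟨⟩
    refine LinearMap.ext fun v => funext fun m => ?_
    rcases m with _ | m <;> simp [fockZ_apply, fockZs_apply] <;> ring⟩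

/-- Matrix elements of distributions in the Fock representation, the distribution
`∑ f j k z^j z*^k` being the limit of its partial sums. The `(m, n)` matrix element of
`z^j z*^k` vanishes unless `j ≤ m` and `k ≤ n`, so that only finitely many terms occur. A finite
function has finitely many nonzero matrix elements, and this identifies the algebra `D(U)_q`
with the algebra of such matrices. -/
def fock (q : ℝ) (f : Distr) (m n : ℕ) : ℂ :=
  ∑ j ∈ Finset.range (m + 1), ∑ k ∈ Finset.range (n + 1),
    f j k * fockRep q (Pol.z q ^ j * Pol.zs q ^ k) (Pi.single n 1) m

/-- Matrix elements of the product of two finite functions. -/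
def fockMul (q : ℝ) (f g : Distr) (m n : ℕ) : ℂ := ∑ᶠ i : ℕ, fock q f m i * fock q g i n

/-- The scalar product `(f, h) = ∫ h* f dν` of finite functions, where
`∫ g dν = (1 - q²) ∑ ψ₀(q^(2j)) q^(-2j)` for a finite function `g` with the radial part
`ψ₀(1 - z z*)`; note that `ψ₀(q^(2j))` is the `j`-th diagonal matrix element of `g`. -/
def inner₀ (q : ℝ) (f h : Distr) : ℂ :=
  (1 - (q : ℂ) ^ 2) * ∑ᶠ j : ℕ, fockMul q (conjDistr h) f j j * (q : ℂ)⁻¹ ^ (2 * j)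

/-- The element `y = 1 - z z*`. -/
def Pol.y (q : ℝ) : Pol q := 1 - Pol.z q * Pol.zs q

/-- The scalar product `(f dz*, h dz*) = ∫ h* f (1 - z z*)² dν` of `(0,1)`-forms with finite
coefficients. -/
def inner₁ (q : ℝ) (f h : Distr) : ℂ := inner₀ q (rmul q f (Pol.y q ^ 2)) h

/-- `B` is the extension by continuity to `D(U)_q'` of the Laplace-Beltrami operator
`□ = -∂̄* ∂̄` on `D(U)_q`: on finite functions, `(B f, h) = -(∂̄ f, ∂̄ h)`. -/
def IsLaplaceBeltrami {q : ℝ} (hq : q ∈ Set.Ioo (0 : ℝ) 1) (B : Distr →L[ℂ] Distr) : Prop :=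
  ∀ f, IsFiniteFun q f → IsFiniteFun q (B f) ∧
    ∀ h, IsFiniteFun q h → inner₀ q (B f) h = -inner₁ q ((dbar hq).op f) ((dbar hq).op h)

/-! ### Functions of `x = (1 - z z*)⁻¹` -/

/-- The finite function `f₀`, that is, the distribution with `z* f₀ = f₀ z = 0` and constant term
`1`. -/
def f₀ (q : ℝ) : Distr := fun j k =>
  if j = k then ∏ i ∈ Finset.range k, (-(q : ℂ) ^ (2 * i) / (1 - (q : ℂ) ^ (2 * (i + 1)))) else 0

/-- The finite function `z^m f₀ z*^m / ((1 - q²) ⋯ (1 - q^(2m)))`, whose only nonzero matrix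
element is the `(m, m)` one, equal to `1`: it is the function of `x` equal to `1` at
`x = q^(-2m)` and to `0` at the other points of the spectrum `q^(-2ℤ₊)` of `x`. -/
def deltaX (q : ℝ) (m : ℕ) : Distr :=
  (∏ i ∈ Finset.range m, (1 - (q : ℂ) ^ (2 * (i + 1))))⁻¹ •
    lmul q (Pol.z q ^ m) (rmul q (f₀ q) (Pol.zs q ^ m))

/-- The distribution `ψ(x) = ∑ ψ(q^(-2m)) deltaX m`, for a function `ψ` on `q^(-2ℤ₊)`; only the
values of `ψ` at the points `q^(-2m)` are used. The terms with `m > j` do not contribute to the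
coefficient of `z^j z*^k`. -/
def ofX (q : ℝ) (ψ : ℝ → ℂ) : Distr := fun j k =>
  ∑ m ∈ Finset.range (j + 1), ψ (q⁻¹ ^ (2 * m)) * deltaX q m j k

theorem f₀_rz {q : ℝ} (hq : q ∈ Set.Ioo (0 : ℝ) 1) : rmul q (f₀ q) (Pol.z q) = 0 := by
  rw [rmul_z]
  ext j k
  have h := cast_pow_ne_one hq (2 * k + 1)
  rw [show 2 * k + 1 + 1 = 2 * (k + 1) by ring] at h
  rcases j with _ | j <;> simp [rz_apply, lz_apply, f₀]
  by_cases hjk : j = k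
  · subst hjk
    simp only [if_true, Finset.prod_range_succ]
    field_simp
    ring
  · simp [hjk]

theorem f₀_lzs {q : ℝ} (hq : q ∈ Set.Ioo (0 : ℝ) 1) : lmul q (Pol.zs q) (f₀ q) = 0 := by
  rw [lmul_zs]
  ext j k
  have h := cast_pow_ne_one hq (2 * j + 1)
  rw [show 2 * j + 1 + 1 = 2 * (j + 1) by ring] at h
  rcases k with _ | k <;> simp [lzs_apply, rzs_apply, f₀]
  by_cases hjk : j = k
  · subst hjk
    simp only [if_true, Finset.prod_range_succ]
    field_simp
    ring
  · simp [hjk]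

theorem lmul_pow_rmul_pow (q : ℝ) (f : Distr) (m j k : ℕ) :
    lmul q (Pol.z q ^ m) (rmul q f (Pol.zs q ^ m)) j k =
      if m ≤ j ∧ m ≤ k then f (j - m) (k - m) else 0 := by
  have hr : ∀ (m : ℕ) (f : Distr) (j k : ℕ), rmul q f (Pol.zs q ^ m) j k =
      if m ≤ k then f j (k - m) else 0 := by
    intro m
    induction m with
    | zero => intro f j k; simp [rmul]
    | succ m ih =>
      intro f j k
      have : rmul q f (Pol.zs q ^ (m + 1)) = rmul q (rmul q f (Pol.zs q)) (Pol.zs q ^ m) := by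
        rw [pow_succ']; simp [rmul]
      rw [this, ih, rmul_zs, rzs_apply]
      by_cases h : m + 1 ≤ k
      · rw [if_pos (by omega), if_neg (by omega), if_pos h]; rfl
      · rw [if_neg h]; split_ifs <;> first | rfl | omega
  have hl : ∀ (m : ℕ) (f : Distr) (j k : ℕ), lmul q (Pol.z q ^ m) f j k =
      if m ≤ j then f (j - m) k else 0 := by
    intro m
    induction m with
    | zero => intro f j k; simp [lmul]
    | succ m ih =>
      intro f j k
      have : lmul q (Pol.z q ^ (m + 1)) f = lmul q (Pol.z q ^ m) (lmul q (Pol.z q) f) := by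
        rw [pow_succ]; simp [lmul]
      rw [this, ih, lmul_z, lz_apply]
      by_cases h : m + 1 ≤ j
      · rw [if_pos (by omega), if_neg (by omega), if_pos h]; rfl
      · rw [if_neg h]; split_ifs <;> first | rfl | omega
  rw [hl, hr]
  split_ifs <;> first | rfl | omega

/-- `(1 - q^(2n)) (1 - q^(2n-2)) ⋯ (1 - q^(2n-2k+2))`. -/
def fallProd (q : ℝ) (n k : ℕ) : ℂ :=
  ∏ i ∈ Finset.range k, (1 - (q : ℂ) ^ (2 * ((n : ℤ) - i)))

theorem fockRep_monomial (q : ℝ) (j k n m : ℕ) :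
    fockRep q (Pol.z q ^ j * Pol.zs q ^ k) (Pi.single n 1) m =
      if k ≤ n ∧ m + k = n + j then fallProd q n k else 0 := by
  have hz : fockRep q (Pol.z q) = fockZ := by simp [fockRep, Pol.z]
  have hzs : fockRep q (Pol.zs q) = fockZs q := by simp [fockRep, Pol.zs]
  have h1 : ∀ (k m : ℕ), ((fockZs q) ^ k) (Pi.single n 1) m =
      if m + k = n then fallProd q n k else 0 := by
    intro k
    induction k with
    | zero => intro m; simp [fallProd, Pi.single_apply]
    | succ k ih =>
      intro m
      rw [pow_succ', Module.End.mul_apply, fockZs_apply, ih]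
      by_cases h : m + (k + 1) = n
      · rw [if_pos (by omega), if_pos h, fallProd, fallProd, Finset.prod_range_succ, mul_comm]
        congr 2
        rw [← zpow_natCast]
        congr 1
        omega
      · rw [if_neg (by omega), if_neg h, mul_zero]
  have h2 : ∀ (j m : ℕ) (v : ℕ → ℂ), (fockZ ^ j) v m = if j ≤ m then v (m - j) else 0 := by
    intro j
    induction j with
    | zero => intro m v; simp
    | succ j ih =>
      intro m v
      rw [pow_succ, Module.End.mul_apply, ih, fockZ_apply]
      by_cases h : j + 1 ≤ m
      · rw [if_pos (by omega), if_neg (by omega), if_pos h]; rfl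
      · rw [if_neg h]; split_ifs <;> first | rfl | omega
  rw [map_mul, map_pow, map_pow, hz, hzs, Module.End.mul_apply, h2, h1]
  split_ifs <;> first | rfl | omega

theorem sum_telescope {q : ℝ} (hq : q ∈ Set.Ioo (0 : ℝ) 1) (n K : ℕ) :
    ∑ k ∈ Finset.range (K + 1), f₀ q k k * fallProd q n k =
      f₀ q K K * (q : ℂ) ^ (2 * K) *
        ∏ i ∈ Finset.range K, (1 - (q : ℂ) ^ (2 * ((n : ℤ) - 1 - i))) := by
  have h0 := cast_ne_zero hq
  induction K with
  | zero => simp [f₀, fallProd]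
  | succ K ih =>
    have h := cast_pow_ne_one hq (2 * K + 1)
    rw [show 2 * K + 1 + 1 = 2 * (K + 1) by ring] at h
    have e1 : fallProd q n (K + 1) = (1 - (q : ℂ) ^ (2 * (n : ℤ))) *
        ∏ i ∈ Finset.range K, (1 - (q : ℂ) ^ (2 * ((n : ℤ) - 1 - i))) := by
      rw [fallProd, Finset.prod_range_succ', mul_comm]
      refine congrArg₂ (· * ·) (by simp) (Finset.prod_congr rfl fun i _ => ?_)
      congr 3; push_cast; ring
    have e2 : f₀ q (K + 1) (K + 1) =
        f₀ q K K * (-(q : ℂ) ^ (2 * K) / (1 - (q : ℂ) ^ (2 * (K + 1)))) := by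
      simp only [f₀, if_true, Finset.prod_range_succ]
    have e3 : (q : ℂ) ^ (2 * ((n : ℤ) - 1 - K)) * (q : ℂ) ^ (2 * (K + 1)) =
        (q : ℂ) ^ (2 * (n : ℤ)) := by
      rw [← zpow_natCast, ← zpow_add₀ h0]; congr 1; push_cast; ring
    rw [Finset.sum_range_succ, ih, e1, e2, Finset.prod_range_succ, ← e3]
    field_simp
    ring

/-- `ψ(x)` acts in the Fock space by the diagonal matrix with the entries `ψ(q^(-2m))`. -/
theorem fock_ofX {q : ℝ} (hq : q ∈ Set.Ioo (0 : ℝ) 1) (ψ : ℝ → ℂ) (m n : ℕ) :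
    fock q (ofX q ψ) m n = if m = n then ψ (q⁻¹ ^ (2 * m)) else 0 := by
  have h0 := cast_ne_zero hq
  have hd : ∀ m j k, deltaX q m j k = if j = k ∧ m ≤ j then
      (∏ i ∈ Finset.range m, (1 - (q : ℂ) ^ (2 * (i + 1))))⁻¹ * f₀ q (j - m) (j - m) else 0 := by
    intro m j k
    rw [deltaX, Pi.smul_apply, Pi.smul_apply, lmul_pow_rmul_pow, smul_eq_mul]
    by_cases h : j = k ∧ m ≤ j
    · obtain ⟨rfl, h⟩ := h
      simp [h]
    · rw [if_neg h]
      split_ifs with h'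
      · rw [f₀, if_neg (by omega), mul_zero]
      · simp
  have hoff : ∀ j k, j ≠ k → ofX q ψ j k = 0 := by
    intro j k h
    exact Finset.sum_eq_zero fun m _ => by rw [hd, if_neg (by tauto), mul_zero]
  have hfall : ∀ a m k : ℕ, fallProd q (a + m) (m + k) = fallProd q (a + m) m * fallProd q a k := by
    intro a m k
    rw [fallProd, Finset.prod_range_add]
    congr 1
    refine Finset.prod_congr rfl fun i _ => ?_
    congr 3; push_cast; ring
  have hfull : ∀ m, fallProd q m m = ∏ i ∈ Finset.range m, (1 - (q : ℂ) ^ (2 * (i + 1))) := by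
    intro m
    rw [fallProd, ← Finset.prod_range_reflect]
    refine Finset.prod_congr rfl fun i hi => ?_
    have := Finset.mem_range.mp hi
    rw [← zpow_natCast]
    congr 2
    omega
  have hne : ∀ m, ∏ i ∈ Finset.range m, (1 - (q : ℂ) ^ (2 * (i + 1))) ≠ 0 := fun m =>
    Finset.prod_ne_zero_iff.mpr fun i _ => cast_pow_ne_one hq (2 * i + 1)
  have hdelta : ∀ a : ℕ, ∑ k ∈ Finset.range (a + 1), f₀ q k k * fallProd q a k =
      if a = 0 then 1 else 0 := by
    intro a
    rw [sum_telescope hq]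
    rcases a with _ | a
    · simp [f₀]
    · rw [if_neg (by omega), Finset.prod_range_succ]
      simp
  by_cases hmn : m = n
  · subst hmn
    rw [if_pos rfl, fock]
    have hrow : ∀ j ∈ Finset.range (m + 1), (∑ k ∈ Finset.range (m + 1), ofX q ψ j k *
        fockRep q (Pol.z q ^ j * Pol.zs q ^ k) (Pi.single m 1) m) =
        ∑ l ∈ Finset.range (j + 1), (fun l t => ψ (q⁻¹ ^ (2 * l)) *
          ((∏ i ∈ Finset.range l, (1 - (q : ℂ) ^ (2 * (i + 1))))⁻¹ * f₀ q t t) *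
          fallProd q m (l + t)) l (j - l) := by
      intro j hj
      have hj' := Finset.mem_range.mp hj
      rw [Finset.sum_eq_single j]
      · rw [fockRep_monomial, if_pos ⟨by omega, rfl⟩, ofX, Finset.sum_mul]
        refine Finset.sum_congr rfl fun l hl => ?_
        have hl' := Finset.mem_range.mp hl
        rw [hd, if_pos ⟨rfl, by omega⟩]
        simp only
        rw [show l + (j - l) = j by omega]
      · intro k _ hk
        rw [hoff j k (Ne.symm hk), zero_mul]
      · intro h; exact absurd hj h
    rw [Finset.sum_congr rfl hrow, Finset.sum_range_diag_flip (m + 1) (fun l t =>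
      ψ (q⁻¹ ^ (2 * l)) * ((∏ i ∈ Finset.range l, (1 - (q : ℂ) ^ (2 * (i + 1))))⁻¹ * f₀ q t t) *
        fallProd q m (l + t)), Finset.sum_range_succ,
      Finset.sum_eq_zero, zero_add]
    · rw [show m + 1 - m = 1 by omega, Finset.sum_range_one, add_zero, hfull]
      have := hne m
      simp only [f₀, if_true, Finset.range_zero, Finset.prod_empty, mul_one]
      field_simp
    · intro l hl
      have hl' := Finset.mem_range.mp hl
      obtain ⟨a, rfl⟩ : ∃ a, m = a + l := ⟨m - l, by omega⟩
      have := hdelta a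
      rw [if_neg (by omega)] at this
      rw [show a + l + 1 - l = a + 1 by omega]
      calc _ = ψ (q⁻¹ ^ (2 * l)) * (∏ i ∈ Finset.range l, (1 - (q : ℂ) ^ (2 * (i + 1))))⁻¹ *
            fallProd q (a + l) l * ∑ k ∈ Finset.range (a + 1), f₀ q k k * fallProd q a k := by
            rw [Finset.mul_sum]
            refine Finset.sum_congr rfl fun k _ => ?_
            rw [hfall]; ring
        _ = 0 := by rw [this, mul_zero]
  · rw [if_neg hmn, fock]
    refine Finset.sum_eq_zero fun j _ => Finset.sum_eq_zero fun k _ => ?_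
    by_cases hjk : j = k
    · rw [fockRep_monomial, if_neg (by omega), mul_zero]
    · rw [hoff j k hjk, zero_mul]

/-- The `q`-difference operator `D : f(t) ↦ (f(q⁻¹ t) - f(q t)) / (q⁻¹ t - q t)`. -/
def qD (q : ℝ) (f : ℝ → ℂ) (t : ℝ) : ℂ :=
  (f (q⁻¹ * t) - f (q * t)) / ((q⁻¹ * t - q * t : ℝ) : ℂ)

end QuantumDisc
end

open QuantumDisc

/-! Everything is computed in the expansion `f = ∑ c(m,n) z^m f₀ z*^n`. Since `1 = ∑ z^i f₀ z*^i /
‖e_i‖²`, the monomial `z^j z*^k` equals `∑ z^(j+i) f₀ z*^(k+i) / ‖e_i‖²`, which gives the formula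
for `coef`. Left `z` and right `z*` shift the indices of `c` up; left `z*` and right `z` shift them
down with nonzero factors; right multiplication by `y = 1 - z z*` multiplies `c(m,n)` by `q^(2n)`.
Matrix elements are `‖e_n‖² c(m,n)`, so finite functions are those with finitely supported `c`, and
both scalar products are diagonal in `c`.

In these terms `∂̄f = (1 - q²)⁻¹ (f z - z f) y⁻¹` (`coef_opDbar`). As `∫ g dν = (1 - q²) Tr(g y⁻¹)`,
cyclicity of the trace gives `(∂̄f, ∂̄h) = Tr(h* (∂̄f z* - z* ∂̄f))`, whence `□f = (1 - q²)⁻¹ (z*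
∂̄f - ∂̄f z*) y`, the operator `laplace`. This formula makes sense for every distribution and is
continuous. It is the only choice: pairing with `z^a f₀ z*^b` recovers each coefficient on finite
functions, and these are dense.

The equality `Ω = q □` then holds on all distributions, by comparing Taylor coefficients
(`act_casimir_eq_laplace`). For `ψ(x)` the array `c` is diagonal, `∂̄` moves it to the subdiagonal
as a first difference, and `laplace` returns it to the diagonal as the second difference that `D
t(q⁻¹t - 1) D` produces at `t = q^(-2m)` (`qD_qD_apply`, `laplace_ofX`). -/

noncomputable section
namespace QuantumDisc

/-! ### Coefficients with respect to `z^m f₀ z*^n` -/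

/-- The squared norm `(1 - q²) ⋯ (1 - q^(2n))` of the vector `e_n` of the Fock space. -/
def normSq (q : ℝ) (n : ℕ) : ℂ := ∏ i ∈ Finset.range n, (1 - (q : ℂ) ^ (2 * (i + 1)))

theorem normSq_zero (q : ℝ) : normSq q 0 = 1 := by simp [normSq]

theorem normSq_succ (q : ℝ) (n : ℕ) :
    normSq q (n + 1) = normSq q n * (1 - (q : ℂ) ^ (2 * (n + 1))) := by
  simp [normSq, Finset.prod_range_succ]

theorem one_sub_pow_ne_zero {q : ℝ} (hq : q ∈ Set.Ioo (0 : ℝ) 1) (n : ℕ) :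
    1 - (q : ℂ) ^ (2 * (n + 1)) ≠ 0 := cast_pow_ne_one hq (2 * n + 1)

theorem normSq_ne_zero {q : ℝ} (hq : q ∈ Set.Ioo (0 : ℝ) 1) (n : ℕ) : normSq q n ≠ 0 :=
  Finset.prod_ne_zero_iff.mpr fun i _ => one_sub_pow_ne_zero hq i

theorem conj_normSq (q : ℝ) (n : ℕ) : (starRingEnd ℂ) (normSq q n) = normSq q n := by
  simp [normSq]

/-- The coefficient of `z^m f₀ z*^n` in the expansion of a distribution. -/
def coef (q : ℝ) (f : Distr) (m n : ℕ) : ℂ :=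
  ∑ i ∈ Finset.range (m + 1), if i ≤ n then f (m - i) (n - i) / normSq q i else 0

/-- A form symmetric in `m` and `n` with a free cutoff: terms beyond either index vanish, so
coefficients at different indices can be summed over a common range. -/
theorem coef_eq_sum (q : ℝ) (f : Distr) {m n M : ℕ} (h : m < M ∨ n < M) :
    coef q f m n = ∑ i ∈ Finset.range M,
      if i ≤ m ∧ i ≤ n then f (m - i) (n - i) / normSq q i else 0 := by
  have h1 : ∀ M', M ≤ M' → (∑ i ∈ Finset.range M,
      if i ≤ m ∧ i ≤ n then f (m - i) (n - i) / normSq q i else 0) =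
      ∑ i ∈ Finset.range M',
        if i ≤ m ∧ i ≤ n then f (m - i) (n - i) / normSq q i else 0 := by
    intro M' hM
    refine Finset.sum_subset (Finset.range_subset_range.mpr hM) fun i _ hi => ?_
    rw [Finset.mem_range, not_lt] at hi
    rw [if_neg (by omega)]
  rw [h1 (M + m + 1) (by omega), coef]
  rw [← Finset.sum_subset (Finset.range_subset_range.mpr (show m + 1 ≤ M + m + 1 by omega))]
  · refine Finset.sum_congr rfl fun i hi => ?_
    have := Finset.mem_range.mp hi
    simp only [show i ≤ m by omega, true_and]
  · intro i _ hi
    rw [Finset.mem_range, not_lt] at hi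
    rw [if_neg (by omega)]

theorem coef_add (q : ℝ) (f g : Distr) (m n : ℕ) :
    coef q (f + g) m n = coef q f m n + coef q g m n := by
  simp only [coef, ← Finset.sum_add_distrib]
  refine Finset.sum_congr rfl fun i _ => ?_
  split_ifs <;> simp [add_div]

theorem coef_smul (q : ℝ) (c : ℂ) (f : Distr) (m n : ℕ) :
    coef q (c • f) m n = c * coef q f m n := by
  simp only [coef, Finset.mul_sum]
  refine Finset.sum_congr rfl fun i _ => ?_
  split_ifs <;> simp [mul_div_assoc]

theorem coef_zero (q : ℝ) (m n : ℕ) : coef q 0 m n = 0 := by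
  simp [coef]

theorem coef_sub (q : ℝ) (f g : Distr) (m n : ℕ) :
    coef q (f - g) m n = coef q f m n - coef q g m n := by
  rw [sub_eq_add_neg, ← neg_one_smul ℂ g, coef_add, coef_smul]; ring

theorem coef_sum (q : ℝ) {ι : Type*} (s : Finset ι) (f : ι → Distr) (m n : ℕ) :
    coef q (∑ i ∈ s, f i) m n = ∑ i ∈ s, coef q (f i) m n := by
  classical
  induction s using Finset.induction_on with
  | empty => simp [coef_zero]
  | insert a s ha ih => rw [Finset.sum_insert ha, Finset.sum_insert ha, coef_add, ih]

theorem coef_conj (q : ℝ) (f : Distr) (m n : ℕ) :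
    coef q (conjDistr f) m n = (starRingEnd ℂ) (coef q f n m) := by
  rw [coef_eq_sum q f (M := m + 1) (by omega), coef_eq_sum q _ (M := m + 1) (by omega), map_sum]
  refine Finset.sum_congr rfl fun i _ => ?_
  by_cases h : i ≤ m ∧ i ≤ n
  · rw [if_pos h, if_pos h.symm, map_div₀, conj_normSq, conjDistr]
  · rw [if_neg h, if_neg (by tauto), map_zero]

theorem coef_lz (q : ℝ) (f : Distr) (m n : ℕ) :
    coef q (lz f) m n = if m = 0 then 0 else coef q f (m - 1) n := by
  rcases m with _ | m
  · simp [coef, lz_apply]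
  · rw [if_neg (by omega), coef, Finset.sum_range_succ, coef]
    simp only [lz_apply, Nat.sub_self, if_true, zero_div, ite_self, add_zero]
    refine Finset.sum_congr (by simp) fun i hi => ?_
    have := Finset.mem_range.mp hi
    rw [if_neg (show m + 1 - i ≠ 0 by omega), show m + 1 - i - 1 = m + 1 - 1 - i by omega]

/-- The involution exchanges left and right multiplication, so the right-hand rules follow from the
left-hand ones. -/
theorem rzs_eq_conj (f : Distr) : rzs f = conjDistr (lz (conjDistr f)) := by
  ext j k
  simp only [rzs_apply, conjDistr, lz_apply]
  split_ifs <;> simp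

theorem rz_eq_conj (q : ℝ) (f : Distr) : rz q f = conjDistr (lzs q (conjDistr f)) := by
  ext j k
  simp only [rz_apply, conjDistr, lzs_apply, lz_apply, rzs_apply]
  split_ifs <;> simp

theorem coef_rzs (q : ℝ) (f : Distr) (m n : ℕ) :
    coef q (rzs f) m n = if n = 0 then 0 else coef q f m (n - 1) := by
  rw [rzs_eq_conj, coef_conj, coef_lz]
  split_ifs <;> simp [coef_conj]

/-- The factor `1 - q^(2i)` cancels the last factor of `normSq q i` and kills the term `i = 0`. This
is what turns multiplication of Taylor series into an index shift of `coef`. -/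
theorem sum_shift {q : ℝ} (hq : q ∈ Set.Ioo (0 : ℝ) 1) (u : ℕ → ℂ) (M : ℕ) :
    ∑ i ∈ Finset.range (M + 1), (1 - (q : ℂ) ^ (2 * i)) * (u i / normSq q i) =
      ∑ i ∈ Finset.range M, u (i + 1) / normSq q i := by
  rw [Finset.sum_range_succ']
  simp only [mul_zero, pow_zero, sub_self, zero_mul, add_zero]
  refine Finset.sum_congr rfl fun i _ => ?_
  have h1 := one_sub_pow_ne_zero hq i
  have h2 := normSq_ne_zero hq i
  rw [normSq_succ]
  field_simp

/-- Left `z*` annihilates `f₀`, so only the lowering part of `z* z^(m+1)` survives. For the sums, `1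
- q^(2(m+1)) = (1 - q^(2(m+1-i))) + q^(2(m+1-i)) (1 - q^(2i))`: the two parts match the two terms of
`lzs`, the second after `sum_shift`. -/
theorem coef_lzs {q : ℝ} (hq : q ∈ Set.Ioo (0 : ℝ) 1) (f : Distr) (m n : ℕ) :
    coef q (lzs q f) m n = (1 - (q : ℂ) ^ (2 * (m + 1))) * coef q f (m + 1) n := by
  have key := sum_shift hq (fun i => if i ≤ m + 1 ∧ i ≤ n then
    (q : ℂ) ^ (2 * (m + 1 - i)) * f (m + 1 - i) (n - i) else 0) (m + 1)
  have split : (1 - (q : ℂ) ^ (2 * (m + 1))) * coef q f (m + 1) n =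
      ∑ i ∈ Finset.range (m + 1 + 1), (if i ≤ m + 1 ∧ i ≤ n then
        (1 - (q : ℂ) ^ (2 * (m + 1 - i))) * f (m + 1 - i) (n - i) / normSq q i else 0) +
      ∑ i ∈ Finset.range (m + 1 + 1), (1 - (q : ℂ) ^ (2 * i)) * ((if i ≤ m + 1 ∧ i ≤ n then
        (q : ℂ) ^ (2 * (m + 1 - i)) * f (m + 1 - i) (n - i) else 0) / normSq q i) := by
    rw [coef_eq_sum q f (M := m + 1 + 1) (by omega), Finset.mul_sum, ← Finset.sum_add_distrib]
    refine Finset.sum_congr rfl fun i hi => ?_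
    have := Finset.mem_range.mp hi
    split_ifs
    · have : (q : ℂ) ^ (2 * (m + 1)) = (q : ℂ) ^ (2 * i) * (q : ℂ) ^ (2 * (m + 1 - i)) := by
        rw [← pow_add]; congr 1; omega
      rw [this]; ring
    · simp
  rw [split, key, Finset.sum_range_succ, coef, add_right_comm, ← Finset.sum_add_distrib]
  -- The top term `i = m + 1` of the first sum carries the factor `1 - q^0 = 0`.
  simp only [Nat.sub_self, mul_zero, pow_zero, sub_self, zero_mul, zero_div, ite_self, add_zero]
  refine Finset.sum_congr rfl fun i hi => ?_
  have := Finset.mem_range.mp hi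
  rw [lzs_apply, rzs_apply]
  by_cases h1 : i ≤ n
  · rw [if_pos h1, if_pos (show i ≤ m + 1 ∧ i ≤ n from ⟨by omega, h1⟩), show m + 1 - (i + 1) = m - i by omega,
      show m + 1 - i = m - i + 1 by omega]
    by_cases h2 : n - i = 0
    · rw [if_pos h2, if_neg (show ¬(i + 1 ≤ m + 1 ∧ i + 1 ≤ n) by omega)]; ring
    · rw [if_neg h2, if_pos (show i + 1 ≤ m + 1 ∧ i + 1 ≤ n by omega),
        show n - (i + 1) = n - i - 1 by omega]
      ring
  · rw [if_neg h1, if_neg (by omega), if_neg (by omega)]; simp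

theorem coef_rz {q : ℝ} (hq : q ∈ Set.Ioo (0 : ℝ) 1) (f : Distr) (m n : ℕ) :
    coef q (rz q f) m n = (1 - (q : ℂ) ^ (2 * (n + 1))) * coef q f m (n + 1) := by
  rw [rz_eq_conj, coef_conj, coef_lzs hq, coef_conj]
  simp

/-- The right-hand side is `(f z - z f) y⁻¹ / (1 - q²)` in coefficients, because `q^(-2n) - q² =
q^(-2n) (1 - q^(2(n+1)))`. Once `sum_shift` has been applied to the shifted coefficient, the `i`-th
term has the factor `q^(-2n+2i) - q²`, which is the geometric sum in `opDbar` up to normalization.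
-/
theorem coef_opDbar {q : ℝ} (hq : q ∈ Set.Ioo (0 : ℝ) 1) (f : Distr) (m n : ℕ) :
    coef q (opDbar q f) m n = (((q : ℂ)⁻¹ ^ (2 * n) - (q : ℂ) ^ 2) * coef q f m (n + 1) -
      (q : ℂ)⁻¹ ^ (2 * n) * (if m = 0 then 0 else coef q f (m - 1) n)) / (1 - (q : ℂ) ^ 2) := by
  have h0 := cast_ne_zero hq
  have h2 := cast_pow_ne_one hq 1
  have key := sum_shift hq (fun i => if i ≤ m ∧ i ≤ n + 1 then f (m - i) (n + 1 - i) else 0) (n + 1)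
  have shifted : ∑ i ∈ Finset.range (n + 1),
      (if i + 1 ≤ m ∧ i + 1 ≤ n + 1 then f (m - (i + 1)) (n + 1 - (i + 1)) else 0) / normSq q i =
      if m = 0 then 0 else coef q f (m - 1) n := by
    rcases m with _ | m
    · simp
    · rw [if_neg (by omega), coef_eq_sum q f (M := n + 1) (by omega)]
      refine Finset.sum_congr rfl fun i _ => ?_
      simp only [Nat.add_le_add_iff_right, Nat.add_sub_add_right, Nat.add_sub_cancel]
      split_ifs <;> simp
  rw [← shifted, ← key, coef_eq_sum q _ (M := n + 1) (by omega),
    coef_eq_sum q f (M := n + 1 + 1) (by omega), Finset.mul_sum, Finset.mul_sum,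
    ← Finset.sum_sub_distrib, Finset.sum_div, Finset.sum_range_succ _ (n + 1)]
  -- The sum on the right is longer by the term `i = n + 1`, where `q^(-2n+2i) - q²` vanishes.
  have hlast : (((q : ℂ)⁻¹ ^ (2 * n) - (q : ℂ) ^ 2) *
      (if n + 1 ≤ m ∧ n + 1 ≤ n + 1 then f (m - (n + 1)) (n + 1 - (n + 1)) / normSq q (n + 1)
        else 0) - (q : ℂ)⁻¹ ^ (2 * n) * ((1 - (q : ℂ) ^ (2 * (n + 1))) *
      ((if n + 1 ≤ m ∧ n + 1 ≤ n + 1 then f (m - (n + 1)) (n + 1 - (n + 1)) else 0) /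
        normSq q (n + 1)))) / (1 - (q : ℂ) ^ 2) = 0 := by
    have : (q : ℂ)⁻¹ ^ (2 * n) * (q : ℂ) ^ (2 * (n + 1)) = (q : ℂ) ^ 2 := by
      rw [inv_pow]; field_simp; ring
    split_ifs
    · rw [div_eq_zero_iff]; left
      linear_combination (f (m - (n + 1)) (n + 1 - (n + 1)) / normSq q (n + 1)) * this
    · simp
  rw [hlast, add_zero]
  refine Finset.sum_congr rfl fun i hi => ?_
  have hi' := Finset.mem_range.mp hi
  have h3 := normSq_ne_zero hq i
  by_cases h : i ≤ m ∧ i ≤ n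
  · have e : (q : ℂ) ^ 2 * (q : ℂ)⁻¹ ^ (2 * (n - i + 1)) =
        (q : ℂ)⁻¹ ^ (2 * n) * (q : ℂ) ^ (2 * i) := by
      rw [inv_pow, inv_pow]
      field_simp
      rw [← pow_add, ← pow_add]; congr 1; omega
    rw [if_pos h, if_pos ⟨h.1, by omega⟩, if_pos ⟨h.1, by omega⟩, opDbar_apply, geom_inv_sq hq,
      show n + 1 - i = n - i + 1 by omega, mul_sub, e]
    field_simp
    ring
  · rw [if_neg h, if_neg (by omega), if_neg (by omega)]; simp

/-! ### Matrix elements and finite functions -/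

theorem fallProd_eq {q : ℝ} (hq : q ∈ Set.Ioo (0 : ℝ) 1) (a k : ℕ) :
    fallProd q (a + k) k = normSq q (a + k) / normSq q a := by
  rw [eq_div_iff (normSq_ne_zero hq a), normSq, normSq, Finset.prod_range_add, mul_comm]
  congr 1
  rw [fallProd, ← Finset.prod_range_reflect]
  refine Finset.prod_congr rfl fun i hi => ?_
  have := Finset.mem_range.mp hi
  rw [← zpow_natCast]
  congr 2
  omega

/-- In row `m` and column `n` the monomial `z^(m-i) z*^k` contributes only for `k = n - i`, with the
value `normSq q n / normSq q i`; the factor `normSq q n` comes out of the sum. -/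
theorem fock_eq {q : ℝ} (hq : q ∈ Set.Ioo (0 : ℝ) 1) (f : Distr) (m n : ℕ) :
    fock q f m n = normSq q n * coef q f m n := by
  rw [fock, ← Finset.sum_range_reflect, coef, Finset.mul_sum]
  refine Finset.sum_congr rfl fun i hi => ?_
  have hi' := Finset.mem_range.mp hi
  by_cases h : i ≤ n
  · rw [if_pos h, Finset.sum_eq_single (n - i)]
    · rw [fockRep_monomial, if_pos (by omega)]
      have := fallProd_eq hq i (n - i)
      rw [show i + (n - i) = n by omega] at this
      rw [this, show m + 1 - 1 - i = m - i by omega]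
      ring
    · intro k hk hne
      have := Finset.mem_range.mp hk
      rw [fockRep_monomial, if_neg (by omega), mul_zero]
    · intro hk
      exact absurd (Finset.mem_range.mpr (by omega)) hk
  · rw [if_neg h, mul_zero]
    refine Finset.sum_eq_zero fun k hk => ?_
    have := Finset.mem_range.mp hk
    rw [fockRep_monomial, if_neg (by omega), mul_zero]

/-- Vanishing of the matrix elements in a square corner forces vanishing of the Taylor
coefficients there. -/
theorem apply_eq_zero_of_coef {q : ℝ} {f : Distr} {N : ℕ}
    (h : ∀ m < N, ∀ n < N, coef q f m n = 0) : ∀ m < N, ∀ n < N, f m n = 0 := by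
  intro m
  induction m using Nat.strong_induction_on with
  | _ m ih =>
    intro hm n hn
    have := h m hm n hn
    rw [coef, Finset.sum_range_succ', Finset.sum_eq_zero] at this
    · simpa [normSq_zero] using this
    · intro i hi
      have := Finset.mem_range.mp hi
      split_ifs
      · rw [ih (m - (i + 1)) (by omega) (by omega) (n - (i + 1)) (by omega), zero_div]
      · rfl

/-- The passage from Taylor coefficients to `coef` is triangular with ones on the diagonal, hence
injective. -/
theorem ext_coef {q : ℝ} {f g : Distr} (h : ∀ m n, coef q f m n = coef q g m n) : f = g := by
  rw [← sub_eq_zero]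
  ext m n
  exact apply_eq_zero_of_coef (q := q) (N := max m n + 1)
    (fun a _ b _ => by rw [coef_sub, h, sub_self]) m (by omega) n (by omega)

theorem lmul_zs_pow_succ (q : ℝ) (f : Distr) (N : ℕ) :
    lmul q (Pol.zs q ^ (N + 1)) f = lzs q (lmul q (Pol.zs q ^ N) f) := by
  rw [← lmul_zs, pow_succ']; simp [lmul]

theorem rmul_z_pow_succ (q : ℝ) (f : Distr) (N : ℕ) :
    rmul q f (Pol.z q ^ (N + 1)) = rz q (rmul q f (Pol.z q ^ N)) := by
  rw [← rmul_z, pow_succ]; simp [rmul]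

theorem coef_lmul_zs_pow_eq_zero {q : ℝ} (hq : q ∈ Set.Ioo (0 : ℝ) 1) (f : Distr) (N m n : ℕ) :
    coef q (lmul q (Pol.zs q ^ N) f) m n = 0 ↔ coef q f (m + N) n = 0 := by
  induction N generalizing m with
  | zero => simp [lmul]
  | succ N ih =>
    rw [lmul_zs_pow_succ, coef_lzs hq, mul_eq_zero, or_iff_right (one_sub_pow_ne_zero hq m), ih,
      show m + 1 + N = m + (N + 1) by omega]

theorem coef_rmul_z_pow_eq_zero {q : ℝ} (hq : q ∈ Set.Ioo (0 : ℝ) 1) (f : Distr) (N m n : ℕ) :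
    coef q (rmul q f (Pol.z q ^ N)) m n = 0 ↔ coef q f m (n + N) = 0 := by
  induction N generalizing n with
  | zero => simp [rmul]
  | succ N ih =>
    rw [rmul_z_pow_succ, coef_rz hq, mul_eq_zero, or_iff_right (one_sub_pow_ne_zero hq n), ih,
      show n + 1 + N = n + (N + 1) by omega]

/-- Left `z*^N` and right `z^N` are shifts by `N` with nonzero weights, so each annihilation
condition says that the coefficients vanish from index `N` on. -/
theorem isFiniteFun_iff {q : ℝ} (hq : q ∈ Set.Ioo (0 : ℝ) 1) (f : Distr) :
    IsFiniteFun q f ↔ ∃ N : ℕ, ∀ m n, N ≤ m ∨ N ≤ n → coef q f m n = 0 := by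
  refine exists_congr fun N => ⟨?_, fun h => ⟨?_, ?_⟩⟩
  · rintro ⟨h1, h2⟩ m n (h | h)
    · obtain ⟨a, rfl⟩ := Nat.exists_eq_add_of_le' h
      rw [← coef_lmul_zs_pow_eq_zero hq, h1, coef_zero]
    · obtain ⟨a, rfl⟩ := Nat.exists_eq_add_of_le' h
      rw [← coef_rmul_z_pow_eq_zero hq, h2, coef_zero]
  · refine ext_coef (q := q) fun m n => ?_
    rw [coef_zero, coef_lmul_zs_pow_eq_zero hq, h _ _ (by omega)]
  · refine ext_coef (q := q) fun m n => ?_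
    rw [coef_zero, coef_rmul_z_pow_eq_zero hq, h _ _ (by omega)]

/-! ### Scalar products in coefficients -/

theorem rmul_y (q : ℝ) (f : Distr) : rmul q f (Pol.y q) = f - rzs (rz q f) := by
  rw [← rmul_zs q, ← rmul_z]
  simp [rmul, Pol.y]

theorem coef_rmul_y {q : ℝ} (hq : q ∈ Set.Ioo (0 : ℝ) 1) (f : Distr) (m n : ℕ) :
    coef q (rmul q f (Pol.y q)) m n = (q : ℂ) ^ (2 * n) * coef q f m n := by
  rw [rmul_y, coef_sub, coef_rzs]
  rcases n with _ | n
  · simp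
  · rw [if_neg (by omega), Nat.add_sub_cancel, coef_rz hq]; ring

theorem coef_rmul_y_sq {q : ℝ} (hq : q ∈ Set.Ioo (0 : ℝ) 1) (f : Distr) (m n : ℕ) :
    coef q (rmul q f (Pol.y q ^ 2)) m n = (q : ℂ) ^ (4 * n) * coef q f m n := by
  have : rmul q f (Pol.y q ^ 2) = rmul q (rmul q f (Pol.y q)) (Pol.y q) := by
    rw [pow_two]; simp [rmul]
  rw [this, coef_rmul_y hq, coef_rmul_y hq]; ring

theorem inner₀_eq_sum {q : ℝ} (hq : q ∈ Set.Ioo (0 : ℝ) 1) (f h : Distr) {N : ℕ}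
    (hf : ∀ m n, N ≤ m ∨ N ≤ n → coef q f m n = 0) :
    inner₀ q f h = (1 - (q : ℂ) ^ 2) * ∑ j ∈ Finset.range N, ∑ i ∈ Finset.range N,
      normSq q i * normSq q j * (q : ℂ)⁻¹ ^ (2 * j) *
        (coef q f i j * (starRingEnd ℂ) (coef q h i j)) := by
  have hmul : ∀ j, fockMul q (conjDistr h) f j j = ∑ i ∈ Finset.range N,
      normSq q i * normSq q j * (coef q f i j * (starRingEnd ℂ) (coef q h i j)) := by
    intro j
    rw [fockMul, finsum_eq_sum_of_support_subset (s := Finset.range N)]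
    · refine Finset.sum_congr rfl fun i _ => ?_
      rw [fock_eq hq, fock_eq hq, coef_conj]; ring
    · intro i hi
      by_contra hN
      rw [Finset.coe_range, Set.mem_Iio, not_lt] at hN
      exact hi (by simp only [fock_eq hq f, hf i j (Or.inl hN), mul_zero])
  rw [inner₀, finsum_eq_sum_of_support_subset (s := Finset.range N)]
  · congr 1
    refine Finset.sum_congr rfl fun j _ => ?_
    rw [hmul, Finset.sum_mul]
    refine Finset.sum_congr rfl fun i _ => ?_
    ring
  · intro j hj
    by_contra hN
    rw [Finset.coe_range, Set.mem_Iio, not_lt] at hN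
    refine hj ?_
    simp only [hmul]
    rw [Finset.sum_eq_zero, zero_mul]
    intro i _
    rw [hf i j (Or.inr hN)]; ring

theorem inner₁_eq_sum {q : ℝ} (hq : q ∈ Set.Ioo (0 : ℝ) 1) (f h : Distr) {N : ℕ}
    (hf : ∀ m n, N ≤ m ∨ N ≤ n → coef q f m n = 0) :
    inner₁ q f h = (1 - (q : ℂ) ^ 2) * ∑ j ∈ Finset.range N, ∑ i ∈ Finset.range N,
      normSq q i * normSq q j * (q : ℂ) ^ (2 * j) *
        (coef q f i j * (starRingEnd ℂ) (coef q h i j)) := by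
  have h0 := cast_ne_zero hq
  rw [inner₁, inner₀_eq_sum hq _ _ (N := N)
    (fun m n hmn => by rw [coef_rmul_y_sq hq, hf m n hmn, mul_zero])]
  congr 1
  refine Finset.sum_congr rfl fun j _ => Finset.sum_congr rfl fun i _ => ?_
  have : (q : ℂ)⁻¹ ^ (2 * j) * (q : ℂ) ^ (4 * j) = (q : ℂ) ^ (2 * j) := by
    rw [inv_pow]; field_simp; ring
  rw [coef_rmul_y_sq hq]
  linear_combination (normSq q i * normSq q j * coef q f i j *
    (starRingEnd ℂ) (coef q h i j)) * this

/-! ### The Laplace-Beltrami operator: existence -/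

/-- The Laplace-Beltrami operator `f ↦ (1 - q²)⁻¹ (z* ∂̄f - (∂̄f) z*) (1 - z z*)`. -/
def laplace (q : ℝ) : Distr →L[ℂ] Distr :=
  (1 - (q : ℂ) ^ 2)⁻¹ • ((rightMul q (Pol.y q)).unop ∘L (lzs q - rzs) ∘L opDbar q)

theorem laplace_apply (q : ℝ) (f : Distr) : laplace q f =
    (1 - (q : ℂ) ^ 2)⁻¹ • rmul q (lzs q (opDbar q f) - rzs (opDbar q f)) (Pol.y q) := rfl

theorem coef_laplace {q : ℝ} (hq : q ∈ Set.Ioo (0 : ℝ) 1) (f : Distr) (m n : ℕ) :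
    coef q (laplace q f) m n = (1 - (q : ℂ) ^ 2)⁻¹ * ((q : ℂ) ^ (2 * n) *
      ((1 - (q : ℂ) ^ (2 * (m + 1))) * coef q (opDbar q f) (m + 1) n -
        if n = 0 then 0 else coef q (opDbar q f) m (n - 1))) := by
  rw [laplace_apply, coef_smul, coef_rmul_y hq, coef_sub, coef_lzs hq, coef_rzs]

theorem coef_opDbar_eq_zero {q : ℝ} (hq : q ∈ Set.Ioo (0 : ℝ) 1) {f : Distr} {N : ℕ}
    (hf : ∀ m n, N ≤ m ∨ N ≤ n → coef q f m n = 0) (m n : ℕ) (h : N + 1 ≤ m ∨ N + 1 ≤ n) :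
    coef q (opDbar q f) m n = 0 := by
  rw [coef_opDbar hq, hf m (n + 1) (by omega)]
  split_ifs
  · simp
  · rw [hf (m - 1) n (by omega)]; simp

/-- Summation by parts, the coefficient form of cyclicity of the trace. The powers of `q` from `y`
and from the weights cancel, and each of the two commutator terms is matched by a shift of one
index. -/
theorem isLaplaceBeltrami_laplace {q : ℝ} (hq : q ∈ Set.Ioo (0 : ℝ) 1) :
    IsLaplaceBeltrami hq (laplace q) := by
  have h2 := cast_pow_ne_one hq 1
  have h0 := cast_ne_zero hq
  intro f hf
  obtain ⟨N, hN⟩ := (isFiniteFun_iff hq f).mp hf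
  have hA := coef_opDbar_eq_zero hq hN
  have hL : ∀ m n, N + 2 ≤ m ∨ N + 2 ≤ n → coef q (laplace q f) m n = 0 := by
    intro m n h
    rw [coef_laplace hq, hA (m + 1) n (by omega)]
    split_ifs
    · simp
    · rw [hA m (n - 1) (by omega)]; simp
  refine ⟨(isFiniteFun_iff hq _).mpr ⟨_, hL⟩, fun h _ => ?_⟩
  change _ = -inner₁ q (opDbar q f) (opDbar q h)
  -- Each of `∂̄` and the commutator with `z*` enlarges the support by at most one, so `N + 2`
  -- serves both products and leaves `A` zero at the edge, where the boundary terms arise.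
  rw [inner₀_eq_sum hq _ _ hL, inner₁_eq_sum hq _ _ (N := N + 2) (fun m n h => hA m n (by omega)),
    ← mul_neg, ← Finset.sum_neg_distrib]
  congr 1
  simp only [← Finset.sum_neg_distrib]
  set A := coef q (opDbar q f) with hAdef
  set H : ℕ → ℕ → ℂ := fun i j => (starRingEnd ℂ) (coef q h i j) with hHdef
  have hleft : ∀ i j, normSq q i * normSq q j * (q : ℂ)⁻¹ ^ (2 * j) *
      (coef q (laplace q f) i j * (starRingEnd ℂ) (coef q h i j)) =
      (1 - (q : ℂ) ^ 2)⁻¹ * (normSq q (i + 1) * normSq q j * A (i + 1) j * H i j) -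
      (1 - (q : ℂ) ^ 2)⁻¹ * (normSq q i * normSq q j * (if j = 0 then 0 else A i (j - 1)) *
        H i j) := by
    intro i j
    rw [coef_laplace hq, normSq_succ, inv_pow]
    simp only [hHdef, hAdef]
    field_simp
  have hright : ∀ i j, -(normSq q i * normSq q j * (q : ℂ) ^ (2 * j) *
      (A i j * (starRingEnd ℂ) (coef q (opDbar q h) i j))) =
      (1 - (q : ℂ) ^ 2)⁻¹ * (normSq q i * normSq q j * A i j * (if i = 0 then 0 else H (i - 1) j)) -
      (1 - (q : ℂ) ^ 2)⁻¹ * (normSq q i * normSq q (j + 1) * A i j * H i (j + 1)) := by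
    intro i j
    rw [coef_opDbar hq, normSq_succ, inv_pow]
    rcases i with _ | i
    · simp [hHdef]
      field_simp
      ring
    · simp [hHdef]
      field_simp
      ring
  simp only [hleft, hright, Finset.sum_sub_distrib, ← Finset.mul_sum]
  congr 2
  · refine Finset.sum_congr rfl fun j _ => ?_
    rw [Finset.sum_range_succ _ (N + 1), Finset.sum_range_succ' _ (N + 1),
      hA (N + 1 + 1) j (by omega)]
    simp
  · rw [Finset.sum_comm, Finset.sum_comm (s := Finset.range (N + 2))
      (f := fun j i => normSq q i * normSq q (j + 1) * A i j * H i (j + 1))]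
    refine Finset.sum_congr rfl fun i _ => ?_
    rw [Finset.sum_range_succ' _ (N + 1), Finset.sum_range_succ _ (N + 1),
      hA i (N + 1) (by omega)]
    simp

/-! ### The Laplace-Beltrami operator: uniqueness -/

/-- The finite function `z^a f₀ z*^b`. -/
def matUnit (q : ℝ) (a b : ℕ) : Distr := lmul q (Pol.z q ^ a) (rmul q (f₀ q) (Pol.zs q ^ b))

/-- Because `z* f₀ = 0` and `f₀ z = 0`, the weighted shifts force every coefficient outside the
corner to vanish. -/
theorem coef_f₀ {q : ℝ} (hq : q ∈ Set.Ioo (0 : ℝ) 1) (m n : ℕ) :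
    coef q (f₀ q) m n = if m = 0 ∧ n = 0 then 1 else 0 := by
  rcases m with _ | m
  · rcases n with _ | n
    · simp [coef, f₀, normSq_zero]
    · have := coef_rz hq (f₀ q) 0 n
      rw [← rmul_z, f₀_rz hq, coef_zero, eq_comm, mul_eq_zero,
        or_iff_right (one_sub_pow_ne_zero hq n)] at this
      simp [this]
  · have := coef_lzs hq (f₀ q) m n
    rw [← lmul_zs, f₀_lzs hq, coef_zero, eq_comm, mul_eq_zero,
      or_iff_right (one_sub_pow_ne_zero hq m)] at this
    simp [this]

theorem coef_matUnit {q : ℝ} (hq : q ∈ Set.Ioo (0 : ℝ) 1) (a b m n : ℕ) :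
    coef q (matUnit q a b) m n = if m = a ∧ n = b then 1 else 0 := by
  have hr : ∀ b m n, coef q (rmul q (f₀ q) (Pol.zs q ^ b)) m n =
      if m = 0 ∧ n = b then 1 else 0 := by
    intro b
    induction b with
    | zero => intro m n; simpa [rmul] using coef_f₀ hq m n
    | succ b ih =>
      intro m n
      have : rmul q (f₀ q) (Pol.zs q ^ (b + 1)) = rzs (rmul q (f₀ q) (Pol.zs q ^ b)) := by
        rw [← rmul_zs q, pow_succ]; simp [rmul]
      rw [this, coef_rzs, ih]
      rcases n with _ | n <;> simp
  induction a generalizing m with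
  | zero => simpa [matUnit, lmul] using hr b m n
  | succ a ih =>
    have : matUnit q (a + 1) b = lz (matUnit q a b) := by
      rw [← lmul_z q, matUnit, pow_succ']; simp [lmul, matUnit]
    rw [this, coef_lz, ih]
    rcases m with _ | m <;> simp

theorem isFiniteFun_matUnit {q : ℝ} (hq : q ∈ Set.Ioo (0 : ℝ) 1) (a b : ℕ) :
    IsFiniteFun q (matUnit q a b) := by
  refine (isFiniteFun_iff hq _).mpr ⟨a + b + 1, fun m n h => ?_⟩
  rw [coef_matUnit hq, if_neg (by omega)]

theorem inner₀_matUnit {q : ℝ} (hq : q ∈ Set.Ioo (0 : ℝ) 1) {f : Distr} (hf : IsFiniteFun q f)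
    (a b : ℕ) : inner₀ q f (matUnit q a b) = (1 - (q : ℂ) ^ 2) *
      (normSq q a * normSq q b * (q : ℂ)⁻¹ ^ (2 * b) * coef q f a b) := by
  obtain ⟨N, hN⟩ := (isFiniteFun_iff hq f).mp hf
  rw [inner₀_eq_sum hq f _ (N := N + a + b + 1) (fun m n h => hN m n (by omega)),
    Finset.sum_eq_single b, Finset.sum_eq_single a]
  · simp [coef_matUnit hq]
  · intro i _ hi
    simp [coef_matUnit hq, hi]
  · intro h; exact absurd (Finset.mem_range.mpr (by omega)) h
  · intro j _ hj
    simp [coef_matUnit hq, hj]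
  · intro h; exact absurd (Finset.mem_range.mpr (by omega)) h

/-- The truncation of a distribution to a square corner of its matrix. -/
def truncate (q : ℝ) (f : Distr) (N : ℕ) : Distr :=
  ∑ a ∈ Finset.range N, ∑ b ∈ Finset.range N, coef q f a b • matUnit q a b

theorem coef_truncate {q : ℝ} (hq : q ∈ Set.Ioo (0 : ℝ) 1) (f : Distr) (N m n : ℕ) :
    coef q (truncate q f N) m n = if m < N ∧ n < N then coef q f m n else 0 := by
  simp only [truncate, coef_sum, coef_smul, coef_matUnit hq, mul_ite, mul_one, mul_zero, ite_and,
    Finset.sum_ite_eq, Finset.sum_ite_irrel, Finset.sum_const_zero, Finset.mem_range]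

theorem isFiniteFun_truncate {q : ℝ} (hq : q ∈ Set.Ioo (0 : ℝ) 1) (f : Distr) (N : ℕ) :
    IsFiniteFun q (truncate q f N) :=
  (isFiniteFun_iff hq _).mpr ⟨N, fun m n h => by rw [coef_truncate hq, if_neg (by omega)]⟩

/-- Each Taylor coefficient depends only on a corner of the array `coef`, so it is eventually
constant along the truncations. -/
theorem tendsto_truncate {q : ℝ} (hq : q ∈ Set.Ioo (0 : ℝ) 1) (f : Distr) :
    Filter.Tendsto (truncate q f) Filter.atTop (nhds f) := by
  refine tendsto_pi_nhds.mpr fun j => tendsto_pi_nhds.mpr fun k => ?_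
  refine tendsto_const_nhds.congr' ?_
  filter_upwards [Filter.eventually_gt_atTop (max j k)] with N hN
  have := apply_eq_zero_of_coef (q := q) (f := f - truncate q f N) (N := N)
    (fun m hm n hn => by rw [coef_sub, coef_truncate hq, if_pos ⟨hm, hn⟩, sub_self])
    j (by omega) k (by omega)
  exact sub_eq_zero.mp this

/-- Pairing with `matUnit q a b` isolates the coefficient at `(a, b)` with a nonzero weight, which
settles finite functions; density and continuity do the rest. -/
theorem IsLaplaceBeltrami.eq_laplace {q : ℝ} (hq : q ∈ Set.Ioo (0 : ℝ) 1)
    {B : Distr →L[ℂ] Distr} (hB : IsLaplaceBeltrami hq B) : B = laplace q := by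
  have hfin : ∀ f, IsFiniteFun q f → B f = laplace q f := by
    intro f hf
    obtain ⟨h1, h2⟩ := hB f hf
    obtain ⟨h3, h4⟩ := isLaplaceBeltrami_laplace hq f hf
    refine ext_coef (q := q) fun a b => ?_
    have h := (h2 _ (isFiniteFun_matUnit hq a b)).trans (h4 _ (isFiniteFun_matUnit hq a b)).symm
    rw [inner₀_matUnit hq h1, inner₀_matUnit hq h3] at h
    exact mul_left_cancel₀ (mul_ne_zero (mul_ne_zero (normSq_ne_zero hq a) (normSq_ne_zero hq b))
      (pow_ne_zero _ (inv_ne_zero (cast_ne_zero hq))))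
      (mul_left_cancel₀ (cast_pow_ne_one hq 1) h)
  refine ContinuousLinearMap.ext fun f => ?_
  refine tendsto_nhds_unique ((B.continuous.tendsto f).comp (tendsto_truncate hq f)) ?_
  refine (((laplace q).continuous.tendsto f).comp (tendsto_truncate hq f)).congr fun N => ?_
  exact (hfin _ (isFiniteFun_truncate hq f N)).symm

/-! ### The Casimir element acts as `q □` -/

theorem act_casimir {q : ℝ} (hq : q ∈ Set.Ioo (0 : ℝ) 1) (f : Distr) :
    (action hq).act (Uq.casimir q) f = opF q (opE q f) + (1 / ((q : ℂ)⁻¹ - (q : ℂ)) ^ 2) •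
      ((q : ℂ)⁻¹ • opKi q f + (q : ℂ) • opK q f - ((q : ℂ)⁻¹ + (q : ℂ)) • f) := by
  simp [action, Uq.casimir, Uq.gen]

/-- Both sides are explicit combinations of index shifts on Taylor coefficients, so the claim is an
identity between rational functions of `√q` and its powers. -/
theorem act_casimir_eq_laplace {q : ℝ} (hq : q ∈ Set.Ioo (0 : ℝ) 1) (f : Distr) :
    (action hq).act (Uq.casimir q) f = (q : ℂ) • laplace q f := by
  have hs := sqrt_sq' hq
  have hs0 := sqrt_ne_zero' hq
  have h0 := cast_ne_zero hq
  have h2 := cast_pow_ne_one hq 1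
  have h5 := sqrt_pow_four_ne_one hq
  have h3 : (1 : ℂ) / ((q : ℂ)⁻¹ - (q : ℂ)) ^ 2 = (q : ℂ) ^ 2 / (1 - (q : ℂ) ^ 2) ^ 2 := by
    rw [show (q : ℂ)⁻¹ - (q : ℂ) = (1 - (q : ℂ) ^ 2) / (q : ℂ) by field_simp]
    field_simp
  rw [act_casimir, laplace_apply, rmul_y, h3]
  ext j k
  -- The composed shifts lower `j` at most once and `k` at most twice, whence the boundary cases.
  rcases j with _ | j <;> rcases k with _ | _ | k <;>
    simp [opK_apply, opKi_apply, opE_apply, opF_apply, opDbar_apply, lzs_apply, rzs_apply,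
      rz_apply, lz_apply, geom_zero] <;>
    simp only [← inv_pow, geom_sq hq, geom_inv_sq hq] <;>
    simp only [← hs, inv_pow, ← pow_mul] <;> field_simp <;> ring

/-! ### Functions of `x` -/

theorem coef_ofX {q : ℝ} (hq : q ∈ Set.Ioo (0 : ℝ) 1) (ψ : ℝ → ℂ) (m n : ℕ) :
    coef q (ofX q ψ) m n = if m = n then ψ (q⁻¹ ^ (2 * m)) / normSq q m else 0 := by
  have h := fock_ofX hq ψ m n
  rw [fock_eq hq] at h
  rw [← mul_right_inj' (normSq_ne_zero hq n), h]
  split_ifs with hmn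
  · subst hmn
    rw [mul_div_cancel₀ _ (normSq_ne_zero hq m)]
  · rw [mul_zero]

theorem coef_opDbar_ofX {q : ℝ} (hq : q ∈ Set.Ioo (0 : ℝ) 1) (ψ : ℝ → ℂ) (m n : ℕ) :
    coef q (opDbar q (ofX q ψ)) m n = if m = n + 1 then (q : ℂ)⁻¹ ^ (2 * n) *
      (ψ (q⁻¹ ^ (2 * (n + 1))) - ψ (q⁻¹ ^ (2 * n))) / (normSq q n * (1 - (q : ℂ) ^ 2))
      else 0 := by
  have h0 := cast_ne_zero hq
  have h2 := cast_pow_ne_one hq 1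
  have h3 := one_sub_pow_ne_zero hq n
  have h4 := normSq_ne_zero hq n
  rw [coef_opDbar hq, coef_ofX hq, coef_ofX hq]
  by_cases h : m = n + 1
  · subst h
    have e : (q : ℂ)⁻¹ ^ (2 * n) - (q : ℂ) ^ 2 =
        (q : ℂ)⁻¹ ^ (2 * n) * (1 - (q : ℂ) ^ (2 * (n + 1))) := by
      rw [inv_pow]; field_simp; ring
    simp only [if_true, Nat.add_sub_cancel, Nat.add_eq_zero_iff, one_ne_zero, and_false, if_false]
    rw [e, normSq_succ]
    field_simp
  · rw [if_neg h, if_neg h]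
    split_ifs
    · simp
    · omega
    · simp

theorem qD_eq {q : ℝ} (hq : q ∈ Set.Ioo (0 : ℝ) 1) (g : ℝ → ℂ) (t : ℝ) :
    qD q g t = (g (q⁻¹ * t) - g (q * t)) / ((t : ℂ) * ((1 - (q : ℂ) ^ 2) / (q : ℂ))) := by
  have h0 := cast_ne_zero hq
  rw [qD]
  congr 1
  push_cast
  field_simp

/-- The values of `D t (q⁻¹ t - 1) D ψ` on the spectrum of `x`. -/
theorem qD_qD_apply {q : ℝ} (hq : q ∈ Set.Ioo (0 : ℝ) 1) (ψ : ℝ → ℂ) (m : ℕ) :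
    qD q (fun t => ((t * (q⁻¹ * t - 1) : ℝ) : ℂ) * qD q ψ t) (q⁻¹ ^ (2 * m)) =
      ((1 - (q : ℂ) ^ (2 * (m + 1))) * (ψ (q⁻¹ ^ (2 * (m + 1))) - ψ (q⁻¹ ^ (2 * m))) -
        (q : ℂ) ^ 2 * (1 - (q : ℂ) ^ (2 * m)) *
          (ψ (q⁻¹ ^ (2 * m)) - if m = 0 then 0 else ψ (q⁻¹ ^ (2 * (m - 1))))) /
        (1 - (q : ℂ) ^ 2) ^ 2 := by
  have h0 := cast_ne_zero hq
  have hq0 : q ≠ 0 := hq.1.ne'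
  have h2 := cast_pow_ne_one hq 1
  have e1 : q⁻¹ * (q⁻¹ * q⁻¹ ^ (2 * m)) = q⁻¹ ^ (2 * (m + 1)) := by ring
  have e2 : q * (q⁻¹ * q⁻¹ ^ (2 * m)) = q⁻¹ ^ (2 * m) := by field_simp
  have e3 : q⁻¹ * (q * q⁻¹ ^ (2 * m)) = q⁻¹ ^ (2 * m) := by field_simp
  simp only [qD_eq hq]
  push_cast
  rw [e1, e2, e3]
  generalize ψ (q⁻¹ ^ (2 * (m + 1))) = a
  rcases m with _ | m
  · generalize ψ (q⁻¹ ^ (2 * 0)) = b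
    -- At `t = 1` the inner operator is evaluated at `q`, where `q⁻¹ q - 1 = 0` removes the term
    -- with `ψ(q²)`, a value off the spectrum.
    rw [if_pos rfl, mul_zero, pow_zero, pow_zero, mul_one, mul_one, inv_mul_cancel₀ h0]
    field_simp
    ring
  · have e4 : q * (q * q⁻¹ ^ (2 * (m + 1))) = q⁻¹ ^ (2 * m) := by
      rw [inv_pow, inv_pow]
      field_simp
      ring
    rw [e4, if_neg (by omega), Nat.add_sub_cancel]
    generalize ψ (q⁻¹ ^ (2 * (m + 1))) = b
    generalize ψ (q⁻¹ ^ (2 * m)) = c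
    rw [inv_pow]
    field_simp
    ring

/-- Off the diagonal both sides vanish. On it, the two commutator terms of `laplace` are the
differences of `ψ` between `q^(-2m)` and its two neighbours, the lower one being absent for `m = 0`.
-/
theorem laplace_ofX {q : ℝ} (hq : q ∈ Set.Ioo (0 : ℝ) 1) (ψ : ℝ → ℂ) :
    (q : ℂ) • laplace q (ofX q ψ) = ofX q (fun x => (q : ℂ) *
      qD q (fun t => ((t * (q⁻¹ * t - 1) : ℝ) : ℂ) * qD q ψ t) x) := by
  have h0 := cast_ne_zero hq
  have h2 := cast_pow_ne_one hq 1
  refine ext_coef (q := q) fun m n => ?_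
  rw [coef_smul, coef_laplace hq, coef_opDbar_ofX hq, coef_opDbar_ofX hq, coef_ofX hq]
  by_cases h : m = n
  · subst h
    rw [if_pos rfl, if_pos rfl, qD_qD_apply hq]
    generalize ψ (q⁻¹ ^ (2 * (m + 1))) = a
    rcases m with _ | m
    · generalize ψ (q⁻¹ ^ (2 * 0)) = b
      rw [if_pos rfl, if_pos rfl, normSq_zero]
      simp only [mul_zero, pow_zero]
      field_simp
      ring
    · have h3 := one_sub_pow_ne_zero hq m
      have h4 := normSq_ne_zero hq m
      rw [if_neg (by omega), if_pos (by omega), if_neg (by omega), Nat.add_sub_cancel,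
        normSq_succ]
      generalize ψ (q⁻¹ ^ (2 * (m + 1))) = b
      generalize ψ (q⁻¹ ^ (2 * m)) = c
      simp only [inv_pow]
      field_simp
      ring
  · rw [if_neg (by omega), if_neg h]
    split_ifs
    · simp
    · omega
    · simp

end QuantumDisc
end

open QuantumDisc
theorem corollary5p4 (q : ℝ) (hq : q ∈ Set.Ioo (0 : ℝ) 1) :
    (∃! B : Distr →L[ℂ] Distr, IsLaplaceBeltrami hq B) ∧
    ∀ B : Distr →L[ℂ] Distr, IsLaplaceBeltrami hq B → ∀ ψ : ℝ → ℂ,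
      (action hq).act (Uq.casimir q) (ofX q ψ) = (q : ℂ) • B (ofX q ψ) ∧
      (q : ℂ) • B (ofX q ψ) =
        ofX q (fun x => (q : ℂ) *
          qD q (fun t => ((t * (q⁻¹ * t - 1) : ℝ) : ℂ) * qD q ψ t) x) := by
  refine ⟨⟨laplace q, isLaplaceBeltrami_laplace hq,
    fun B hB => IsLaplaceBeltrami.eq_laplace hq hB⟩, fun B hB ψ => ?_⟩
  rw [IsLaplaceBeltrami.eq_laplace hq hB]
  exact ⟨act_casimir_eq_laplace hq _, laplace_ofX hq ψ⟩
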